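/- Let $(\mathbb K,\delta)$ be a differentially closed field of characteristic zero (an existentially closed model of the theory of differential integral domains of characteristic zero) which, as a structure in the language $\{0,1,+,-,\times,\delta\}$, is $\kappa$-saturated for a cardinal $\kappa$; a subset of $\mathbb K$ is called small if it has fewer than $\kappa$ elements. Let $(k,\delta)$ be a small differential subfield of $\mathbb K$. An affine $D$-variety over $(k,\delta)$ is an affine variety $V\subseteq\mathbb A^n$ over $k$ with a morphism $s:V\to\tau V$ over $k$ that is a section of the projection $\tau V\to V$. Here the prolongation $\tau V\subseteq\mathbb A^{2n}$ is given by the equations $f(x)=0$ and $f^\delta(x)+\sum_{i=1}^n\frac{\partial f}{\partial x_i}(x)\,y_i=0$ for all $f$ in the ideal $I(V)$ of $V$, where $f^\delta$ is $f$ with $\delta$ applied to its coefficients. A $D$-point of $(V,s)$ is a point $a\in V(\mathbb K)$ such that $\{a\}$ is a $D$-subvariety of $(V,s)$ over $\mathbb K$, i.e. $s$ restricts to $\{a\}\to\tau\{a\}$ (equivalently $s(a)=(a,\delta a)$). If $V$ is irreducible over $k$, the generic type of $(V,s)$ over $k$ is the complete type over $k$ whose realisations in $\mathbb K$ are exactly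 the $D$-points of $(V,s)$ lying in no proper subvariety of $V$ over $k$. For a tuple $a$ from $\mathbb K$ and small sets $B\subseteq A\subseteq\mathbb K$, $\operatorname{tp}(a/A)$ is a nonforking extension of $\operatorname{tp}(a/B)$ if $\operatorname{tr.deg.}(a,\delta a,\dots,\delta^\ell a/\operatorname{dcl}(A))=\operatorname{tr.deg.}(a,\delta a,\dots,\delta^\ell a/\operatorname{dcl}(B))$ for all $\ell\ge 0$. A complete type over $B$ is stationary if it has a unique nonforking extension to every small set containing $B$. The variety $V$ is absolutely irreducible if its base extension to every field extension of $k$ is irreducible. **Proposition.** Let $(V,s)$ be an affine $D$-variety over $(k,\delta)$ with $V$ irreducible over $k$. Then there is a unique generic type of $(V,s)$ over $k$, and $V$ is absolutely irreducible if and only if this type is stationary. -/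

import Mathlib

open scoped FirstOrder Cardinal

universe u v w

namespace DVar

/-! ### Affine varieties -/

/-- An affine variety `V ⊆ 𝔸^σ` over a field `k`, given by the radical ideal `I(V)` of all
polynomials over `k` that vanish on it. -/
@[ext]
structure AffineVariety (k : Type u) [Field k] (σ : Type v) where
  /-- the ideal `I(V)` -/
  ideal : Ideal (MvPolynomial σ k)
  isRadical : ideal.IsRadical

namespace AffineVariety

section Basic

variable {k : Type u} [Field k] {σ : Type v} {σ' : Type w}

/-- The co-ordinate ring `k[V] = k[x] / I(V)`. -/
abbrev CoordRing (V : AffineVariety k σ) : Type (max u v) := MvPolynomial σ k ⧸ V.ideal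

/-- The co-ordinate function `x_i + I(V)`. -/
noncomputable def coord (V : AffineVariety k σ) (i : σ) : V.CoordRing :=
  Ideal.Quotient.mk V.ideal (MvPolynomial.X i)

/-- The `L`-points of `V`. -/
def points (V : AffineVariety k σ) (L : Type*) [Field L] [Algebra k L] : Set (σ → L) :=
  {a | ∀ f ∈ V.ideal, MvPolynomial.aeval a f = 0}

/-- `W ⊆ V`, for varieties over the same field. -/
def IsSubvariety (W V : AffineVariety k σ) : Prop := V.ideal ≤ W.ideal

/-- `V` is irreducible (over `k`): its co-ordinate ring is an integral domain. -/
def IsIrreducible (V : AffineVariety k σ) : Prop := V.ideal.IsPrime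

/-- The base extension `V_L`, a variety over `L`. Its ideal is the extension of `I(V)`, which is
already radical in characteristic zero. -/
noncomputable def baseChange (V : AffineVariety k σ) (L : Type*) [Field L] [Algebra k L] :
    AffineVariety L σ where
  ideal := (V.ideal.map (MvPolynomial.map (algebraMap k L))).radical
  isRadical := Ideal.radical_isRadical _

/-- `V` is absolutely irreducible: its base extension to any field extension is irreducible. -/
def IsAbsolutelyIrreducible (V : AffineVariety k σ) : Prop :=
  ∀ (L : Type u) [Field L] [Algebra k L], (V.baseChange L).IsIrreducible

/-- The variety whose only point is the `k`-rational point `a`. -/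
noncomputable def singleton (a : σ → k) : AffineVariety k σ where
  ideal := RingHom.ker (MvPolynomial.aeval a : MvPolynomial σ k →ₐ[k] k)
  isRadical := (RingHom.ker_isPrime _).isRadical

/-- A morphism `V → W` over `k`, given by the regular functions on `V` that are its co-ordinates. -/
structure Morphism (V : AffineVariety k σ) (W : AffineVariety k σ') where
  /-- the co-ordinates of the morphism -/
  component : σ' → V.CoordRing
  mapsTo : ∀ g ∈ W.ideal, MvPolynomial.aeval component g = 0

/-- Restriction of regular functions from `V` (over `k`) to a subvariety `W ⊆ V_L` (over `L`). -/
noncomputable def restrict (V : AffineVariety k σ) {L : Type*} [Field L] [Algebra k L]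
    (W : AffineVariety L σ) (h : W.IsSubvariety (V.baseChange L)) :
    V.CoordRing →+* W.CoordRing :=
  Ideal.quotientMap W.ideal (MvPolynomial.map (algebraMap k L))
    (Ideal.map_le_iff_le_comap.1 (Ideal.le_radical.trans h))

end Basic

/-! ### Prolongations and `D`-varieties -/

section Prolongation

variable {k : Type u} [Field k] [Differential k] {σ : Type v} [Fintype σ]

/-- `f^δ`: the derivation of `k` applied to the coefficients of `f`. -/
noncomputable def coeffDeriv (f : MvPolynomial σ k) : MvPolynomial σ k :=
  ∑ m ∈ f.support, MvPolynomial.monomial m (Differential.deriv (f.coeff m))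

/-- The polynomial `f^δ(x) + ∑ i, (∂f/∂x_i) y_i`, where `x_i` is `X (inl i)` and `y_i` is
`X (inr i)`. -/
noncomputable def prolongPoly (f : MvPolynomial σ k) : MvPolynomial (σ ⊕ σ) k :=
  MvPolynomial.rename Sum.inl (coeffDeriv f) +
    ∑ i, MvPolynomial.rename Sum.inl (MvPolynomial.pderiv i f) * MvPolynomial.X (Sum.inr i)

/-- The prolongation `τV` of `V`. -/
noncomputable def prolongation (V : AffineVariety k σ) : AffineVariety k (σ ⊕ σ) where
  ideal := (Ideal.span
    ((MvPolynomial.rename Sum.inl '' (V.ideal : Set (MvPolynomial σ k))) ∪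
      (prolongPoly '' (V.ideal : Set (MvPolynomial σ k))))).radical
  isRadical := Ideal.radical_isRadical _

end Prolongation

end AffineVariety

open AffineVariety

/-- An affine `D`-variety `(V, s)` over `(k, δ)`: an affine variety `V` with a section
`s : V → τV` of the projection `τV → V` to the `x` co-ordinates. -/
structure DVariety (k : Type u) [Field k] [Differential k] (σ : Type v) [Fintype σ] where
  /-- the variety -/
  V : AffineVariety k σ
  /-- the morphism to the prolongation -/
  s : Morphism V V.prolongation
  isSection : ∀ i, s.component (Sum.inl i) = V.coord i

namespace DVariety

variable {k : Type u} [Field k] [Differential k] {σ : Type v} [Fintype σ]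

/-- `W` is a `D`-subvariety of `(V, s)` over the extension `K` of `k`: it is contained in `V_K`, and
`s` restricts to a morphism `W → τW`. -/
def IsDSubvariety (X : DVariety k σ) {K : Type*} [Field K] [Differential K] [Algebra k K]
    (W : AffineVariety K σ) : Prop :=
  ∃ h : W.IsSubvariety (X.V.baseChange K),
    ∃ t : Morphism W W.prolongation, ∀ j, t.component j = X.V.restrict W h (X.s.component j)

/-- `a` is a `D`-point of `(V, s)`: the singleton `{a}` is a `D`-subvariety over `K`. -/
def IsDPoint (X : DVariety k σ) {K : Type*} [Field K] [Differential K] [Algebra k K]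
    (a : σ → K) : Prop :=
  X.IsDSubvariety (AffineVariety.singleton a)

/-- `a` is a generic `D`-point of `(V, s)` over `k`: a `D`-point that lies in no proper subvariety
of `V` over `k`. -/
def IsGenericDPoint (X : DVariety k σ) {K : Type*} [Field K] [Differential K] [Algebra k K]
    (a : σ → K) : Prop :=
  X.IsDPoint a ∧ ∀ W : AffineVariety k σ, W.IsSubvariety X.V → W ≠ X.V → a ∉ W.points K

end DVariety

/-! ### The language of differential rings and differentially closed fields -/

/-- Function symbols of the language of differential rings. -/
inductive DiffRingFunc : ℕ → Type
  | zero : DiffRingFunc 0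
  | one : DiffRingFunc 0
  | add : DiffRingFunc 2
  | sub : DiffRingFunc 2
  | mul : DiffRingFunc 2
  | deriv : DiffRingFunc 1

/-- The language `{0, 1, +, -, ×, δ}` of differential rings. -/
def diffRing : FirstOrder.Language where
  Functions := DiffRingFunc
  Relations := fun _ => Empty

/-- A differential ring as a structure in the language of differential rings. -/
instance diffRingStructure (R : Type*) [CommRing R] [Differential R] : diffRing.Structure R where
  funMap := fun {_} f =>
    match f with
    | .zero => fun _ => 0
    | .one => fun _ => 1
    | .add => fun x => x 0 + x 1
    | .sub => fun x => x 0 - x 1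
    | .mul => fun x => x 0 * x 1
    | .deriv => fun x => Differential.deriv (x 0)
  RelMap := fun r => nomatch r

/-- The differential field `K` is differentially closed, that is, an existentially closed model of
the theory of differential integral domains of characteristic zero: a finite system `E` of equations
and `I` of inequations between terms with parameters in `K` that has a solution in some differential
integral domain extending `K` has a solution in `K`. -/
def IsDifferentiallyClosed (K : Type u) [Field K] [Differential K] : Prop :=
  CharZero K ∧
  ∀ (m : ℕ) (E I : Finset (diffRing.Term (K ⊕ Fin m) × diffRing.Term (K ⊕ Fin m))),
    (∃ (R : Type u) (_ : CommRing R) (_ : IsDomain R) (_ : Differential R) (_ : Algebra K R)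
        (_ : DifferentialAlgebra K R) (x : Fin m → R),
      (∀ e ∈ E, e.1.realize (Sum.elim (algebraMap K R) x) =
        e.2.realize (Sum.elim (algebraMap K R) x)) ∧
      (∀ e ∈ I, e.1.realize (Sum.elim (algebraMap K R) x) ≠
        e.2.realize (Sum.elim (algebraMap K R) x))) →
    ∃ x : Fin m → K,
      (∀ e ∈ E, e.1.realize (Sum.elim id x) = e.2.realize (Sum.elim id x)) ∧
      (∀ e ∈ I, e.1.realize (Sum.elim id x) ≠ e.2.realize (Sum.elim id x))

/-! ### Types, saturation, definable closure -/

section Types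

variable {K : Type u} [Field K] [Differential K]

/-- The space `S_n(A)` of complete `n`-types over the parameter set `A ⊆ K`. -/
abbrev TypeSpace (A : Set K) (n : ℕ) : Type _ :=
  ((diffRing[[A]]).completeTheory K).CompleteType (Fin n)

/-- The complete type `tp(a/A)`. -/
noncomputable def tp (A : Set K) {n : ℕ} (a : Fin n → K) : TypeSpace A n :=
  ((diffRing[[A]]).completeTheory K).typeOf a

variable (K) in
/-- `K` is `κ`-saturated: complete types in finitely many variables over fewer than `κ` parameters
are realised in `K`. -/
def IsSaturated (κ : Cardinal.{u}) : Prop :=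
  ∀ A : Set K, #A < κ → ∀ (n : ℕ) (p : TypeSpace A n), ∃ a : Fin n → K, tp A a = p

/-- The definable closure of `A`. -/
def dcl (A : Set K) : Set K := {b | A.Definable₁ diffRing {b}}

/-! ### Dimension, independence, nonforking, stationarity -/

/-- The dimension of the tuple `a` over the subfield `F`: the sequence
`ℓ ↦ tr.deg.(a, δ a, …, δ^ℓ a / F)`. -/
noncomputable def dimSeq (F : Subfield K) {n : ℕ} (a : Fin n → K) (ℓ : ℕ) : Cardinal.{u} :=
  Algebra.trdeg F
    (IntermediateField.adjoin F
      {x : K | ∃ i ≤ ℓ, ∃ j, x = (fun y : K => Differential.deriv y)^[i] (a j)})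

/-- `a` is independent from `A` over `B`: `dim(a/dcl(A)) = dim(a/dcl(B))`. The set `dcl(A)` is a
subfield of `K`, so that the subfield generated by it is `dcl(A)` itself. -/
def Indep {n : ℕ} (a : Fin n → K) (B A : Set K) : Prop :=
  dimSeq (Subfield.closure (dcl A)) a = dimSeq (Subfield.closure (dcl B)) a

/-- `q` is a nonforking extension of `p`: for some `a`, `q = tp(a/A)` and `p = tp(a/B)`, and `a` is
independent from `A` over `B`. -/
def IsNonforkingExtension {B A : Set K} {n : ℕ} (p : TypeSpace B n) (q : TypeSpace A n) : Prop :=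
  ∃ a : Fin n → K, tp A a = q ∧ tp B a = p ∧ Indep a B A

/-- `p` is stationary: it has a unique nonforking extension to every (small, that is, of cardinality
less than `κ`) set containing its parameter set. -/
def IsStationary (κ : Cardinal.{u}) {B : Set K} {n : ℕ} (p : TypeSpace B n) : Prop :=
  ∀ A : Set K, B ⊆ A → #A < κ → ∃! q : TypeSpace A n, IsNonforkingExtension p q

/-- `p` is the generic type of `(V, s)` over `k`: the complete type over `k` whose realisations are
the generic `D`-points of `(V, s)` over `k`. -/
def IsGenericType {k : Type u} [Field k] [Differential k] [Algebra k K] {n : ℕ}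
    (X : DVariety k (Fin n)) (p : TypeSpace (Set.range (algebraMap k K)) n) : Prop :=
  ∀ a : Fin n → K, tp (Set.range (algebraMap k K)) a = p ↔ X.IsGenericDPoint a

end Types

end DVar

/-! The equations δx = s(x) define a derivation on k[x] (`polyDeriv`), and s landing in τV makes
I(V) a differential ideal (`polyDeriv_mem`). At a solution of δx = s(x) evaluation is a differential
homomorphism, so by quantifier elimination the type of a D-point over a small differential field F ⊇
k is determined by its ideal in F[x] (`sameTerms_iff_ker_eq`, `tp_eq_iff_sameTerms`). Conversely
every prime differential ideal of F[x] is the ideal of a solution in 𝕂 (`exists_point`). The generic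
D-points are the solutions with ideal I(V) over k, which gives the generic type.

The derivatives of such a point are polynomials in it, and dcl(A) is the differential field
generated by A (`closure_dcl`). Hence nonforking means that a transcendence basis of k(V) chosen
among the co-ordinates stays independent over that field (`indep_iff`). If V is absolutely
irreducible, the radical of the extended ideal is prime and differential, so it has a solution
generic for it. Every nonforking realisation has exactly this ideal, since a larger one would impose
a relation on the basis. So the type is stationary.

Conversely, over F = k^alg every realisation is nonforking. If f and g do not vanish on V_F, there
are prime differential ideals contracting to I(V), one omitting f and one omitting g
(`exists_prime_differential_comap_eq`). Stationarity makes the corresponding points have the same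
ideal over F. It is prime, omits f and g, and contains I(V_F), so fg does not vanish on V_F. Thus
V_F is irreducible, and over an algebraically closed field irreducibility persists in all
extensions.

One fact underlies both the algebra and the model theory: when nonzero integers are invertible, an
ideal maximal among the differential ideals disjoint from a multiplicative set is prime
(`exists_prime_differential_ideal`). In a tensor product it amalgamates differential domains
(`exists_amalgam`). Together with existential closedness and saturation, this gives back and forth
(`SameTerms.exists_extend`) and the description of dcl. -/

namespace DVar

open scoped TensorProduct

/-! ### Prime differential ideals in characteristic zero -/

section DifferentialIdeals

variable {R : Type*} [CommRing R]

/-- If `a ^ m * (δ a) ^ j` lies in a differential ideal, powers of `a` can be traded for powers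
of `δ a`. -/
lemma pow_deriv_mem (δ : Derivation ℤ R R) (hℚ : ∀ n : ℕ, n ≠ 0 → IsUnit (n : R))
    {I : Ideal R} (hI : ∀ x ∈ I, δ x ∈ I) {a : R} (m : ℕ) :
    ∀ j : ℕ, a ^ m * δ a ^ j ∈ I → δ a ^ (j + 2 * m) ∈ I := by
  induction m with
  | zero => intro j h; simpa using h
  | succ m ih =>
    intro j h
    -- Differentiating trades one factor `a` for one `δ a`. The extra factor `δ a` restores `δ a ^
    -- j` in the other term of the product rule, which thereby becomes a multiple of the given
    -- element.
    have h1 := I.mul_mem_left (δ a) (hI _ h)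
    have h2 : δ a * δ (a ^ (m + 1) * δ a ^ j) =
        ((m + 1 : ℕ) : R) * (a ^ m * δ a ^ (j + 2)) + (j * δ (δ a)) * (a ^ (m + 1) * δ a ^ j) := by
      rw [Derivation.leibniz, Derivation.leibniz_pow, Derivation.leibniz_pow]
      rcases j with _ | j
      · simp; ring
      · simp; ring
    rw [h2] at h1
    have h3 := (I.add_mem_iff_left (I.mul_mem_left _ h)).1 h1
    have h4 := (Ideal.unit_mul_mem_iff_mem I (hℚ _ m.succ_ne_zero)).1 h3
    have := ih _ h4
    convert this using 2
    ring

/-- Trading all m factors in a^m ∈ I gives (δa)^(2m) ∈ I. This is where invertibility of the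
integers enters. -/
lemma deriv_mem_radical (δ : Derivation ℤ R R) (hℚ : ∀ n : ℕ, n ≠ 0 → IsUnit (n : R))
    {I : Ideal R} (hI : ∀ x ∈ I, δ x ∈ I) {a : R} (ha : a ∈ I.radical) : δ a ∈ I.radical := by
  obtain ⟨m, hm⟩ := ha
  exact ⟨0 + 2 * m, pow_deriv_mem δ hℚ hI m 0 (by simpa using hm)⟩

/-- A differential ideal disjoint from a multiplicative set extends to a prime differential ideal
disjoint from it. -/
lemma exists_prime_differential_ideal (δ : Derivation ℤ R R)
    (hℚ : ∀ n : ℕ, n ≠ 0 → IsUnit (n : R)) {I : Ideal R} (hI : ∀ x ∈ I, δ x ∈ I)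
    (S : Submonoid R) (hS : ∀ x ∈ S, x ∉ I) :
    ∃ P : Ideal R, P.IsPrime ∧ I ≤ P ∧ (∀ x ∈ P, δ x ∈ P) ∧ ∀ x ∈ S, x ∉ P := by
  obtain ⟨P, hIP, ⟨⟨hPδ, hPS⟩, hPmax⟩⟩ := zorn_le_nonempty₀
    {J : Ideal R | (∀ x ∈ J, δ x ∈ J) ∧ ∀ x ∈ S, x ∉ J} (by
      intro c hc hchain J₀ hJ₀
      have hdir : DirectedOn (· ≤ ·) c := hchain.directedOn
      refine ⟨sSup c, ⟨?_, ?_⟩, fun J hJ => le_sSup hJ⟩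
      · intro x hx
        obtain ⟨J, hJ, hxJ⟩ := (Submodule.mem_sSup_of_directed ⟨J₀, hJ₀⟩ hdir).1 hx
        exact (le_sSup hJ : J ≤ sSup c) ((hc hJ).1 x hxJ)
      · intro x hxS hx
        obtain ⟨J, hJ, hxJ⟩ := (Submodule.mem_sSup_of_directed ⟨J₀, hJ₀⟩ hdir).1 hx
        exact (hc hJ).2 x hxS hxJ) I ⟨hI, hS⟩
  have hrad : P.radical ≤ P := by
    refine hPmax ⟨fun x hx => deriv_mem_radical δ hℚ hPδ hx, ?_⟩ Ideal.le_radical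
    rintro x hxS ⟨n, hn⟩
    exact hPS _ (S.pow_mem hxS n) hn
  -- Because `P` is radical, each colon ideal (P : a) is again differential.
  have hcolon : ∀ a b : R, a * b ∈ P → a * δ b ∈ P := by
    intro a b hab
    refine hrad ⟨2, ?_⟩
    have h1 := hPδ _ hab
    rw [Derivation.leibniz, smul_eq_mul, smul_eq_mul] at h1
    have h2 : (a * δ b) ^ 2 = (a * δ b) * (a * δ b + b * δ a) - (δ b * δ a) * (a * b) := by ring
    rw [h2]
    exact P.sub_mem (P.mul_mem_left _ h1) (P.mul_mem_left _ hab)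
  -- Otherwise (P : a) would be a differential ideal disjoint from `S`, hence inside `P` by
  -- maximality, and it contains `b`.
  have key : ∀ a b : R, a * b ∈ P → b ∉ P → ∃ s ∈ S, a * s ∈ P := by
    intro a b hab hb
    by_contra! hcon
    let Q : Ideal R :=
      { carrier := {x | a * x ∈ P}
        add_mem' := fun {x y} hx hy => by
          simpa [mul_add] using P.add_mem hx hy
        zero_mem' := by simp
        smul_mem' := fun c x hx => by
          have := P.mul_mem_left c hx
          simpa [mul_left_comm] using this }
    have hle : Q ≤ P := hPmax ⟨fun x hx => hcolon a x hx, fun x hx => hcon x hx⟩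
      (fun x hx => P.mul_mem_left a hx)
    exact hb (hle hab)
  refine ⟨P, ⟨?_, ?_⟩, hIP, hPδ, hPS⟩
  · rw [Ideal.ne_top_iff_one]
    exact hPS 1 S.one_mem
  · intro a b hab
    by_contra! hcon
    -- Two uses of `key` replace first `b` and then `a` by elements of `S`, producing an element of
    -- `S` in `P`.
    obtain ⟨s, hs, hsP⟩ := key a b hab hcon.2
    obtain ⟨t, ht, htP⟩ := key s a (by rwa [mul_comm]) hcon.1
    exact hPS _ (S.mul_mem hs ht) htP

/-- The derivation induced on the quotient by a differential ideal. -/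
noncomputable def quotientDeriv (δ : Derivation ℤ R R) (I : Ideal R) (hI : ∀ x ∈ I, δ x ∈ I) :
    Derivation ℤ (R ⧸ I) (R ⧸ I) :=
  Derivation.mk'
    ((QuotientAddGroup.map I.toAddSubgroup I.toAddSubgroup δ.toLinearMap.toAddMonoidHom
      (fun x hx => hI x hx)).toIntLinearMap : (R ⧸ I) →ₗ[ℤ] (R ⧸ I)) (by
    intro x y
    obtain ⟨x, rfl⟩ := Ideal.Quotient.mk_surjective x
    obtain ⟨y, rfl⟩ := Ideal.Quotient.mk_surjective y
    change Ideal.Quotient.mk I (δ (x * y)) =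
      Ideal.Quotient.mk I x * Ideal.Quotient.mk I (δ y) +
        Ideal.Quotient.mk I y * Ideal.Quotient.mk I (δ x)
    rw [Derivation.leibniz]
    simp)

end DifferentialIdeals

/-! ### Amalgamation of differential rings -/

section Amalgam

variable {K R : Type u} [CommRing K] [CommRing R]

/-- The derivation `δ₁ ⊗ 1 + 1 ⊗ δ₂`. -/
noncomputable def tensorDeriv (δ₁ : Derivation ℤ K K) (δ₂ : Derivation ℤ R R) :
    Derivation ℤ (K ⊗[ℤ] R) (K ⊗[ℤ] R) :=
  Derivation.mk' (TensorProduct.map δ₁.toLinearMap LinearMap.id +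
      TensorProduct.map LinearMap.id δ₂.toLinearMap) (by
    intro x y
    induction x with
    | zero => simp
    | add x x' hx hx' => rw [add_mul, map_add, hx, hx', map_add]; simp only [smul_eq_mul]; ring
    | tmul a b =>
      induction y with
      | zero => simp
      | add y y' hy hy' => rw [mul_add, map_add, hy, hy', map_add]; simp only [smul_eq_mul]; ring
      | tmul c d =>
        rw [Algebra.TensorProduct.tmul_mul_tmul]
        change δ₁ (a * c) ⊗ₜ[ℤ] (b * d) + (a * c) ⊗ₜ[ℤ] δ₂ (b * d) =
          a ⊗ₜ[ℤ] b * (δ₁ c ⊗ₜ[ℤ] d + c ⊗ₜ[ℤ] δ₂ d) + c ⊗ₜ[ℤ] d * (δ₁ a ⊗ₜ[ℤ] b + a ⊗ₜ[ℤ] δ₂ b)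
        simp only [Derivation.leibniz, smul_eq_mul, mul_add, TensorProduct.add_tmul,
          TensorProduct.tmul_add, Algebra.TensorProduct.tmul_mul_tmul, mul_comm c, mul_comm d]
        abel)

lemma tensorDeriv_tmul (δ₁ : Derivation ℤ K K) (δ₂ : Derivation ℤ R R) (a : K) (b : R) :
    tensorDeriv δ₁ δ₂ (a ⊗ₜ b) = δ₁ a ⊗ₜ b + a ⊗ₜ δ₂ b := rfl

/-- Two differential rings can be amalgamated over a set of pairs closed under the derivation, in a
differential domain in which prescribed elements stay nonzero. -/
lemma exists_amalgam [Differential K] [Differential R]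
    (hℚ : ∀ n : ℕ, n ≠ 0 → IsUnit (n : K)) (D : Set (K × R))
    (hD : ∀ p ∈ D, (Differential.deriv p.1, Differential.deriv p.2) ∈ D)
    {T : Type*} [CommRing T] (i₀ : K →+* T) (j₀ : R →+* T) (h₀ : ∀ p ∈ D, i₀ p.1 = j₀ p.2)
    (S : Submonoid (K ⊗[ℤ] R))
    (hS : ∀ x ∈ S, Algebra.TensorProduct.productMap i₀.toIntAlgHom j₀.toIntAlgHom x ≠ 0) :
    ∃ (A : Type u) (_ : CommRing A) (_ : IsDomain A) (_ : Differential A)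
      (i : K →+* A) (j : R →+* A),
      (∀ x, i (Differential.deriv x) = Differential.deriv (i x)) ∧
      (∀ x, j (Differential.deriv x) = Differential.deriv (j x)) ∧
      (∀ p ∈ D, i p.1 = j p.2) ∧
      ∀ x ∈ S, Algebra.TensorProduct.productMap i.toIntAlgHom j.toIntAlgHom x ≠ 0 := by
  let δ : Derivation ℤ (K ⊗[ℤ] R) (K ⊗[ℤ] R) := tensorDeriv Differential.deriv Differential.deriv
  let I : Ideal (K ⊗[ℤ] R) :=
    Ideal.span {z | ∃ p ∈ D, z = p.1 ⊗ₜ (1 : R) - (1 : K) ⊗ₜ p.2}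
  have hI : ∀ x ∈ I, δ x ∈ I := by
    intro x hx
    refine Submodule.span_induction ?_ ?_ ?_ ?_ hx
    · rintro _ ⟨p, hp, rfl⟩
      refine Ideal.subset_span ⟨_, hD p hp, ?_⟩
      simp [δ, tensorDeriv_tmul]
    · simp
    · intro x y _ _ hx hy
      rw [map_add]
      exact I.add_mem hx hy
    · intro a x hx' hx
      rw [smul_eq_mul, Derivation.leibniz]
      exact I.add_mem (I.mul_mem_left _ hx) (by
        rw [smul_eq_mul, mul_comm]; exact I.mul_mem_left _ hx')
  -- The ring `T` carries no derivation. Its only role is to show that the identifications in `D` do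
  -- not already kill an element of `S`.
  have hker : I ≤ RingHom.ker (Algebra.TensorProduct.productMap i₀.toIntAlgHom j₀.toIntAlgHom) := by
    refine Ideal.span_le.2 ?_
    rintro _ ⟨p, hp, rfl⟩
    simp [RingHom.mem_ker, h₀ p hp]
  have hunit : ∀ n : ℕ, n ≠ 0 → IsUnit (n : K ⊗[ℤ] R) := by
    intro n hn
    have := (hℚ n hn).map (Algebra.TensorProduct.includeLeft : K →ₐ[ℤ] K ⊗[ℤ] R)
    simpa using this
  obtain ⟨P, hP, hIP, hPδ, hPS⟩ := exists_prime_differential_ideal δ hunit hI S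
    (fun x hx hxI => hS x hx (hker hxI))
  let i : K →+* (K ⊗[ℤ] R) ⧸ P := (Ideal.Quotient.mk P).comp
    (Algebra.TensorProduct.includeLeft : K →ₐ[ℤ] K ⊗[ℤ] R).toRingHom
  let j : R →+* (K ⊗[ℤ] R) ⧸ P := (Ideal.Quotient.mk P).comp
    (Algebra.TensorProduct.includeRight : R →ₐ[ℤ] K ⊗[ℤ] R).toRingHom
  refine ⟨(K ⊗[ℤ] R) ⧸ P, inferInstance, inferInstance, ⟨quotientDeriv δ P hPδ⟩, i, j,
    ?_, ?_, ?_, ?_⟩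
  · intro x
    change _ = Ideal.Quotient.mk P (δ (x ⊗ₜ 1))
    simp [δ, tensorDeriv_tmul, i]
  · intro x
    change _ = Ideal.Quotient.mk P (δ (1 ⊗ₜ x))
    simp [δ, tensorDeriv_tmul, j]
  · intro p hp
    exact Ideal.Quotient.eq.2 (hIP (Ideal.subset_span ⟨p, hp, rfl⟩))
  · intro x hx h
    refine hPS x hx (Ideal.Quotient.eq_zero_iff_mem.1 ?_)
    rw [← h]
    have : (Ideal.Quotient.mkₐ ℤ P) =
        Algebra.TensorProduct.productMap i.toIntAlgHom j.toIntAlgHom := by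
      refine Algebra.TensorProduct.ext' fun a b => ?_
      change Ideal.Quotient.mk P (a ⊗ₜ b) =
        Ideal.Quotient.mk P (a ⊗ₜ 1) * Ideal.Quotient.mk P (1 ⊗ₜ b)
      rw [← map_mul, Algebra.TensorProduct.tmul_mul_tmul, mul_one, one_mul]
    exact DFunLike.congr_fun this x

end Amalgam

end DVar

namespace DVar

open FirstOrder FirstOrder.Language

/-! ### Differential terms and partial isomorphisms -/

section Terms

variable {α β : Type*} {R S : Type*} [CommRing R] [Differential R] [CommRing S] [Differential S]

/-- Two tuples in differential rings satisfy the same equalities of differential terms. -/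
def SameTerms (v : α → R) (w : α → S) : Prop :=
  ∀ t s : diffRing.Term α, t.realize v = s.realize v ↔ t.realize w = s.realize w

lemma SameTerms.symm {v : α → R} {w : α → S} (h : SameTerms v w) : SameTerms w v :=
  fun t s => (h t s).symm

lemma SameTerms.comp {v : α → R} {w : α → S} (h : SameTerms v w) (e : β → α) :
    SameTerms (v ∘ e) (w ∘ e) := fun t s => by
  simpa using h (t.relabel e) (s.relabel e)

section Build

/-- The term `0`. -/
def termZero : diffRing.Term α := Term.func (L := diffRing) DiffRingFunc.zero Fin.elim0
/-- The term `1`. -/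
def termOne : diffRing.Term α := Term.func (L := diffRing) DiffRingFunc.one Fin.elim0
/-- The sum of two terms. -/
def termAdd (t s : diffRing.Term α) : diffRing.Term α :=
  Functions.apply₂ (L := diffRing) DiffRingFunc.add t s
/-- The difference of two terms. -/
def termSub (t s : diffRing.Term α) : diffRing.Term α :=
  Functions.apply₂ (L := diffRing) DiffRingFunc.sub t s
/-- The product of two terms. -/
def termMul (t s : diffRing.Term α) : diffRing.Term α :=
  Functions.apply₂ (L := diffRing) DiffRingFunc.mul t s
/-- The derivative of a term. -/
def termDeriv (t : diffRing.Term α) : diffRing.Term α :=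
  Functions.apply₁ (L := diffRing) DiffRingFunc.deriv t

variable (v : α → R) (t s : diffRing.Term α)

@[simp] lemma realize_termZero : (termZero : diffRing.Term α).realize v = 0 := rfl
@[simp] lemma realize_termOne : (termOne : diffRing.Term α).realize v = 1 := rfl
@[simp] lemma realize_termAdd : (termAdd t s).realize v = t.realize v + s.realize v := rfl
@[simp] lemma realize_termSub : (termSub t s).realize v = t.realize v - s.realize v := rfl
@[simp] lemma realize_termMul : (termMul t s).realize v = t.realize v * s.realize v := rfl
@[simp] lemma realize_termDeriv :
    (termDeriv t).realize v = Differential.deriv (t.realize v) := rfl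

end Build

lemma realize_map (φ : R →+* S)
    (hφ : ∀ x, φ (Differential.deriv x) = Differential.deriv (φ x)) (v : α → R)
    (t : diffRing.Term α) : t.realize (φ ∘ v) = φ (t.realize v) := by
  induction t with
  | var => rfl
  | func f ts ih =>
    cases f with
    | zero => exact (map_zero φ).symm
    | one => exact (map_one φ).symm
    | add =>
      change (ts 0).realize _ + (ts 1).realize _ = φ ((ts 0).realize _ + (ts 1).realize _)
      rw [ih, ih, map_add]
    | sub =>
      change (ts 0).realize _ - (ts 1).realize _ = φ ((ts 0).realize _ - (ts 1).realize _)
      rw [ih, ih, map_sub]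
    | mul =>
      change (ts 0).realize _ * (ts 1).realize _ = φ ((ts 0).realize _ * (ts 1).realize _)
      rw [ih, ih, map_mul]
    | deriv =>
      change Differential.deriv ((ts 0).realize _) = φ (Differential.deriv ((ts 0).realize _))
      rw [ih, hφ]

lemma sameTerms_map (φ : R →+* S)
    (hφ : ∀ x, φ (Differential.deriv x) = Differential.deriv (φ x))
    (hinj : Function.Injective φ) (v : α → R) : SameTerms v (φ ∘ v) := fun t s => by
  rw [realize_map φ hφ, realize_map φ hφ, hinj.eq_iff]

/-- Two differential homomorphisms with the same kernel give tuples satisfying the same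
equalities. -/
lemma sameTerms_of_ker_eq {A : Type*} [CommRing A] [Differential A] (φ : A →+* R) (ψ : A →+* S)
    (hφ : ∀ x, φ (Differential.deriv x) = Differential.deriv (φ x))
    (hψ : ∀ x, ψ (Differential.deriv x) = Differential.deriv (ψ x))
    (hker : RingHom.ker φ = RingHom.ker ψ) (v : α → A) : SameTerms (φ ∘ v) (ψ ∘ v) := fun t s => by
  rw [realize_map φ hφ, realize_map φ hφ, realize_map ψ hψ, realize_map ψ hψ]
  rw [← sub_eq_zero, ← map_sub, ← RingHom.mem_ker, hker, RingHom.mem_ker, map_sub, sub_eq_zero]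

end Terms

/-! ### Saturation and types as sets of formulas -/

section Saturation

variable {K : Type u} [Field K] [Differential K]

/-- By compactness a family finitely satisfiable in `K` is consistent with the complete theory, so
it lies in a complete type, which saturation realises. -/
lemma IsSaturated.exists_realize {κ : Cardinal.{u}} (hκ : IsSaturated K κ) {A : Set K}
    (hA : #A < κ) {m : ℕ} {ι : Type*} (φ : ι → (diffRing[[A]]).Formula (Fin m))
    (h : ∀ J : Finset ι, ∃ a : Fin m → K, ∀ j ∈ J, (φ j).Realize a) :
    ∃ a : Fin m → K, ∀ j, (φ j).Realize a := by
  classical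
  let T := (diffRing[[A]]).completeTheory K
  let T' := ((diffRing[[A]]).lhomWithConstants (Fin m)).onTheory T
  have hsat : (T' ∪ Set.range fun j => Formula.equivSentence (φ j)).IsSatisfiable := by
    let U : Option ι → ((diffRing[[A]])[[Fin m]]).Theory := fun o =>
      o.elim T' (fun j => {Formula.equivSentence (φ j)})
    have hU : Theory.IsSatisfiable (⋃ o, U o) := by
      rw [Theory.isSatisfiable_iUnion_iff_isSatisfiable_iUnion_finset]
      intro J
      obtain ⟨a, ha⟩ := h (J.eraseNone)
      let _ : (constantsOn (Fin m)).Structure K := constantsOn.structure a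
      have : Theory.Model K (⋃ o ∈ J, U o) := by
        refine ⟨fun ψ hψ => ?_⟩
        simp only [Set.mem_iUnion] at hψ
        obtain ⟨o, ho, hψ⟩ := hψ
        rcases o with _ | j
        · exact (Language.Theory.model_iff_subset_completeTheory.2
            (Language.Theory.model_iff_subset_completeTheory.1
              ((LHom.onTheory_model _ T).2 inferInstance))).realize_of_mem ψ hψ
        · have hψ : ψ = Formula.equivSentence (φ j) := hψ
          subst hψ
          rw [Formula.realize_equivSentence]
          exact ha j (by simpa using ho)
      exact Theory.Model.isSatisfiable K
    refine hU.mono ?_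
    rintro ψ (hψ | ⟨j, rfl⟩)
    · exact Set.mem_iUnion.2 ⟨none, hψ⟩
    · exact Set.mem_iUnion.2 ⟨some j, rfl⟩
  have hne := mt (Theory.CompleteType.setOfPred_subset_eq_empty_iff (T := T) _).1
    (not_not.2 hsat)
  obtain ⟨p, hp⟩ := Set.nonempty_iff_ne_empty.2 hne
  obtain ⟨a, ha⟩ := hκ A hA m p
  refine ⟨a, fun j => ?_⟩
  have : Formula.equivSentence (φ j) ∈ p := hp ⟨j, rfl⟩
  rw [← ha] at this
  exact Theory.CompleteType.formula_mem_typeOf.1 this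

/-- Constants for `A` are traded for free variables, so that types over different parameter sets are
compared in the one language of differential rings. -/
lemma tp_eq_iff {A : Set K} {n : ℕ} {a b : Fin n → K} :
    tp A a = tp A b ↔ ∀ φ : diffRing.Formula (A ⊕ Fin n),
      φ.Realize (Sum.elim (↑) a) ↔ φ.Realize (Sum.elim (↑) b) := by
  have h1 : tp A a = tp A b ↔
      ∀ φ : (diffRing[[A]]).Formula (Fin n), φ.Realize a ↔ φ.Realize b := by
    constructor
    · intro h φ
      rw [← Theory.CompleteType.formula_mem_typeOf (T := (diffRing[[A]]).completeTheory K),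
        ← Theory.CompleteType.formula_mem_typeOf (T := (diffRing[[A]]).completeTheory K)]
      exact (SetLike.ext_iff.1 h) _
    · intro h
      refine SetLike.ext fun φ => ?_
      exact Theory.CompleteType.mem_typeOf.trans
        ((h _).trans Theory.CompleteType.mem_typeOf.symm)
  rw [h1]
  constructor
  · intro h φ
    obtain ⟨ψ, hψ⟩ := Set.definable_iff_exists_formula_sum.2
      ⟨φ, (rfl : {v : Fin n → K | φ.Realize (Sum.elim (↑) v)} = _)⟩
    have ha := Set.ext_iff.1 hψ a
    have hb := Set.ext_iff.1 hψ b
    exact ha.trans ((h ψ).trans hb.symm)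
  · intro h φ
    obtain ⟨ψ, hψ⟩ := Set.definable_iff_exists_formula_sum.1
      ⟨φ, (rfl : Set.ofPred φ.Realize = _)⟩
    have ha := Set.ext_iff.1 hψ a
    have hb := Set.ext_iff.1 hψ b
    exact ha.trans ((h ψ).trans hb.symm)

lemma IsSaturated.exists_realize_sum {κ : Cardinal.{u}} (hκ : IsSaturated K κ) {α : Type u}
    (hα : #α < κ) (v : α → K) {m : ℕ} {ι : Type*} (φ : ι → diffRing.Formula (α ⊕ Fin m))
    (h : ∀ J : Finset ι, ∃ a : Fin m → K, ∀ j ∈ J, (φ j).Realize (Sum.elim v a)) :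
    ∃ a : Fin m → K, ∀ j, (φ j).Realize (Sum.elim v a) := by
  have key : ∀ j, ∃ ψ : (diffRing[[Set.range v]]).Formula (Fin m),
      ∀ a : Fin m → K, ψ.Realize a ↔ (φ j).Realize (Sum.elim v a) := by
    intro j
    obtain ⟨ψ, hψ⟩ := Set.definable_iff_exists_formula_sum (L := diffRing) (A := Set.range v).2
      ⟨(φ j).relabel (Sum.map (Set.rangeFactorization v) id), rfl⟩
    refine ⟨ψ, fun a => (Set.ext_iff.1 hψ a).symm.trans ?_⟩
    change ((φ j).relabel _).Realize _ ↔ _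
    rw [Formula.realize_relabel]
    have : (Sum.elim (↑) a ∘ Sum.map (Set.rangeFactorization v) id : α ⊕ Fin m → K) =
        Sum.elim v a := by
      ext x
      rcases x with x | x <;> rfl
    rw [this]
  choose ψ hψ using key
  obtain ⟨a, ha⟩ := hκ.exists_realize (Cardinal.mk_range_le.trans_lt hα) ψ (fun J => by
    obtain ⟨a, ha⟩ := h J
    exact ⟨a, fun j hj => (hψ j a).2 (ha j hj)⟩)
  exact ⟨a, fun j => (hψ j a).1 (ha j)⟩

end Saturation

end DVar

namespace DVar

open FirstOrder FirstOrder.Language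
open scoped TensorProduct

/-! ### Extending partial isomorphisms -/

section Extension

/-- Fields over a common subfield embed in a common ring. -/
lemma exists_ring_amalgam {F K E : Type u} [Field F] [Field K] [Field E] (f : F →+* K)
    (g : F →+* E) : ∃ (T : Type u) (_ : CommRing T) (i : K →+* T) (j : E →+* T),
      (∀ x, i (f x) = j (g x)) ∧ Function.Injective j := by
  let _ : Algebra F K := f.toAlgebra
  let _ : Algebra F E := g.toAlgebra
  refine ⟨K ⊗[F] E, inferInstance,
    (Algebra.TensorProduct.includeLeft : K →ₐ[F] K ⊗[F] E).toRingHom,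
    (Algebra.TensorProduct.includeRight : E →ₐ[F] K ⊗[F] E).toRingHom, fun x => ?_,
    Algebra.TensorProduct.includeRight_injective (algebraMap F K).injective⟩
  change (algebraMap F K x) ⊗ₜ[F] (1 : E) = (1 : K) ⊗ₜ[F] algebraMap F E x
  rw [Algebra.algebraMap_eq_smul_one, Algebra.algebraMap_eq_smul_one, TensorProduct.smul_tmul]

lemma isUnit_natCast {K : Type*} [Field K] [CharZero K] (n : ℕ) (hn : n ≠ 0) : IsUnit (n : K) :=
  (Nat.cast_ne_zero.2 hn).isUnit

variable {K : Type u} [Field K] [Differential K]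

/-- A tuple in a differential domain extending a saturated differentially closed field `K` has a
copy in `K` over any small tuple. -/
lemma exists_sameTerms_of_hom (hK : IsDifferentiallyClosed K) {κ : Cardinal.{u}}
    (hκ : IsSaturated K κ) {α : Type u} (hα : #α < κ) (v : α → K)
    {S : Type u} [CommRing S] [IsDomain S] [Differential S] (i : K →+* S)
    (hi : ∀ x, i (Differential.deriv x) = Differential.deriv (i x)) {m : ℕ} (x : Fin m → S) :
    ∃ d : Fin m → K, SameTerms (Sum.elim v d) (Sum.elim (i ∘ v) x) := by
  classical
  let P : diffRing.Term (α ⊕ Fin m) × diffRing.Term (α ⊕ Fin m) → Prop := fun e =>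
    e.1.realize (Sum.elim (i ∘ v) x) = e.2.realize (Sum.elim (i ∘ v) x)
  -- The quantifier-free diagram of `x` over the parameters: for each pair of terms, the equation or
  -- the inequation that holds in `S`. Existential closedness solves each finite part in `K`, and
  -- saturation solves the whole.
  let φ : diffRing.Term (α ⊕ Fin m) × diffRing.Term (α ⊕ Fin m) → diffRing.Formula (α ⊕ Fin m) :=
    fun e => if P e then e.1.equal e.2 else (e.1.equal e.2).not
  have hφ : ∀ e (d : Fin m → K), (φ e).Realize (Sum.elim v d) ↔
      (P e ↔ e.1.realize (Sum.elim v d) = e.2.realize (Sum.elim v d)) := by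
    intro e d
    by_cases he : P e
    · simp only [φ, if_pos he, Formula.realize_equal, true_iff, he]
    · simp only [φ, if_neg he, Formula.realize_not, Formula.realize_equal, false_iff, he]
  obtain ⟨d, hd⟩ := hκ.exists_realize_sum hα v φ (by
    intro J
    let r : diffRing.Term (α ⊕ Fin m) → diffRing.Term (K ⊕ Fin m) :=
      fun t => t.relabel (Sum.map v id)
    have hr : ∀ (t : diffRing.Term (α ⊕ Fin m)) {T : Type u} [CommRing T] [Differential T]
        (f : K → T) (y : Fin m → T),
        (r t).realize (Sum.elim f y) = t.realize (Sum.elim (f ∘ v) y) := by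
      intro t T _ _ f y
      simp only [r, Term.realize_relabel]
      congr 1
      ext z
      rcases z with z | z <;> rfl
    let _ : Algebra K S := i.toAlgebra
    obtain ⟨d, hE, hI⟩ := hK.2 m ((J.filter P).image fun e => (r e.1, r e.2))
      ((J.filter fun e => ¬ P e).image fun e => (r e.1, r e.2))
      ⟨S, inferInstance, inferInstance, inferInstance, inferInstance, ⟨fun a => (hi a).symm⟩, x, by
        simp only [Finset.mem_image, Finset.mem_filter]
        rintro _ ⟨e, he, rfl⟩
        rw [hr, hr]
        exact he.2, by
        simp only [Finset.mem_image, Finset.mem_filter]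
        rintro _ ⟨e, he, rfl⟩
        rw [hr, hr]
        exact he.2⟩
    refine ⟨d, fun e he => (hφ e d).2 ?_⟩
    by_cases hP : P e
    · have := hE (r e.1, r e.2) (Finset.mem_image_of_mem _ (Finset.mem_filter.2 ⟨he, hP⟩))
      rw [hr, hr] at this
      exact iff_of_true hP this
    · have := hI (r e.1, r e.2) (Finset.mem_image_of_mem _ (Finset.mem_filter.2 ⟨he, hP⟩))
      rw [hr, hr] at this
      exact iff_of_false hP this)
  exact ⟨d, fun t s => ((hφ (t, s) d).1 (hd (t, s))).symm⟩

/-- The values of the differential terms at a pair of tuples. -/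
def termSubring {α : Type*} {R S : Type*} [CommRing R] [Differential R] [CommRing S]
    [Differential S] (v : α → R) (w : α → S) : Subring (R × S) where
  carrier := Set.range fun t : diffRing.Term α => (t.realize v, t.realize w)
  zero_mem' := ⟨termZero, rfl⟩
  one_mem' := ⟨termOne, rfl⟩
  add_mem' := by
    rintro _ _ ⟨t, rfl⟩ ⟨s, rfl⟩
    exact ⟨termAdd t s, rfl⟩
  mul_mem' := by
    rintro _ _ ⟨t, rfl⟩ ⟨s, rfl⟩
    exact ⟨termMul t s, rfl⟩
  neg_mem' := by
    rintro _ ⟨t, rfl⟩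
    exact ⟨termSub termZero t, by ext <;> simp⟩

/-- Homogeneity and universality: in a saturated differentially closed field, a small partial
isomorphism to a differential domain extends to one having prescribed elements in its range. -/
lemma SameTerms.exists_extend (hK : IsDifferentiallyClosed K) {κ : Cardinal.{u}}
    (hκ : IsSaturated K κ) {α : Type u} (hα : #α < κ) {v : α → K}
    {R : Type u} [CommRing R] [IsDomain R] [Differential R] {w : α → R} (h : SameTerms v w)
    {m : ℕ} (c : Fin m → R) :
    ∃ d : Fin m → K, SameTerms (Sum.elim v d) (Sum.elim w c) := by
  have := hK.1
  -- `D` is the graph of the isomorphism between the differential subrings generated by `v` and `w`.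
  let D := termSubring v w
  have hinj : ∀ p ∈ D, ∀ q ∈ D, p.1 = q.1 ↔ p.2 = q.2 := by
    rintro _ ⟨t, rfl⟩ _ ⟨s, rfl⟩
    exact h t s
  let f : D →+* K := (RingHom.fst K R).comp D.subtype
  let g : D →+* R := (RingHom.snd K R).comp D.subtype
  have hf : Function.Injective f := fun p q hpq =>
    Subtype.ext (Prod.ext hpq ((hinj p p.2 q q.2).1 hpq))
  have hg : Function.Injective g := fun p q hpq =>
    Subtype.ext (Prod.ext ((hinj p p.2 q q.2).2 hpq) hpq)
  have : IsDomain D := hf.isDomain f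
  have hg' : Function.Injective ((algebraMap R (FractionRing R)).comp g) :=
    (IsFractionRing.injective R _).comp hg
  -- The tensor product of the two fields over the fraction field of `D` is the witness ring. It
  -- keeps the nonzero elements of `R` nonzero, so that `R` will embed in the amalgam.
  obtain ⟨T, _, i₀, j₁, hij₀, hj₁⟩ := exists_ring_amalgam
    (IsFractionRing.lift hf : FractionRing D →+* K)
    (IsFractionRing.lift hg' : FractionRing D →+* FractionRing R)
  let j₀ : R →+* T := j₁.comp (algebraMap R (FractionRing R))
  have hj₀ : Function.Injective j₀ := hj₁.comp (IsFractionRing.injective R _)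
  obtain ⟨S, _, _, _, i, j, hi, hj, hij, hne⟩ := exists_amalgam (K := K) (R := R) isUnit_natCast
    (D : Set (K × R)) (by
      rintro _ ⟨t, rfl⟩
      exact ⟨termDeriv t, rfl⟩) i₀ j₀ (by
      intro p hp
      have := hij₀ (algebraMap D _ ⟨p, hp⟩)
      rwa [IsFractionRing.lift_algebraMap, IsFractionRing.lift_algebraMap] at this)
    ((nonZeroDivisors R).map (Algebra.TensorProduct.includeRight : R →ₐ[ℤ] K ⊗[ℤ] R)) (by
      rintro _ ⟨r, hr, rfl⟩
      have h1 : Algebra.TensorProduct.productMap i₀.toIntAlgHom j₀.toIntAlgHom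
          ((1 : K) ⊗ₜ[ℤ] r) = j₀ r := by simp
      change Algebra.TensorProduct.productMap i₀.toIntAlgHom j₀.toIntAlgHom
          ((1 : K) ⊗ₜ[ℤ] r) ≠ 0
      rw [h1]
      exact (map_ne_zero_iff j₀ hj₀).2 (nonZeroDivisors.ne_zero hr))
  have hjinj : Function.Injective j := by
    rw [injective_iff_map_eq_zero]
    intro r hr
    by_contra hr0
    refine hne _ ⟨r, mem_nonZeroDivisors_of_ne_zero hr0, rfl⟩ ?_
    change Algebra.TensorProduct.productMap i.toIntAlgHom j.toIntAlgHom ((1 : K) ⊗ₜ[ℤ] r) = 0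
    simp [hr]
  obtain ⟨d, hd⟩ := exists_sameTerms_of_hom hK hκ hα v i hi (j ∘ c)
  refine ⟨d, fun t s => (hd t s).trans ?_⟩
  have : (Sum.elim (i ∘ v) (j ∘ c) : α ⊕ Fin m → S) = j ∘ Sum.elim w c := by
    ext z
    rcases z with z | z
    · exact hij (v z, w z) ⟨Term.var z, rfl⟩
    · rfl
  rw [this]
  exact (sameTerms_map j hj hjinj _ t s).symm

end Extension

/-! ### Quantifier elimination by back and forth -/

section QuantifierElimination

variable {K : Type u} [Field K] [Differential K]

lemma card_sum_fin_lt {κ : Cardinal.{u}} (hℵ : ℵ₀ < κ) {α : Type u} (hα : #α < κ) (m : ℕ) :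
    #(α ⊕ Fin m) < κ := by
  rw [Cardinal.mk_sum]
  refine Cardinal.add_lt_of_lt hℵ.le (by simpa using hα) ?_
  simpa using (Cardinal.natCast_lt_aleph0 (n := m)).trans hℵ

/-- Induction on the formula. Only the quantifier needs an argument: `SameTerms.exists_extend`
matches a new element on either side, and the relation is symmetric. -/
lemma realize_iff_of_sameTerms (hK : IsDifferentiallyClosed K) {κ : Cardinal.{u}}
    (hκ : IsSaturated K κ) (hℵ : ℵ₀ < κ) {α : Type u} (hα : #α < κ) {v w : α → K} {m : ℕ}
    (φ : diffRing.BoundedFormula α m) :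
    ∀ xs ys : Fin m → K, SameTerms (Sum.elim v xs) (Sum.elim w ys) →
      (φ.Realize v xs ↔ φ.Realize w ys) := by
  induction φ with
  | falsum => exact fun _ _ _ => Iff.rfl
  | equal t s => exact fun _ _ h => h t s
  | rel r => exact nomatch r
  | imp φ ψ ih1 ih2 =>
    intro xs ys h
    exact imp_congr (ih1 xs ys h) (ih2 xs ys h)
  | @all m φ ih =>
    have step : ∀ {v w : α → K} {xs ys : Fin m → K}, SameTerms (Sum.elim v xs) (Sum.elim w ys) →
        ∀ y : K, ∃ x : K, SameTerms (Sum.elim v (Fin.snoc xs x : Fin (m + 1) → K))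
          (Sum.elim w (Fin.snoc ys y : Fin (m + 1) → K)) := by
      intro v w xs ys h y
      obtain ⟨d, hd⟩ := h.exists_extend hK hκ (card_sum_fin_lt hℵ hα m) ![y]
      refine ⟨d 0, ?_⟩
      have := hd.comp (Sum.elim (Sum.inl ∘ Sum.inl)
        (Fin.snoc (Sum.inl ∘ Sum.inr) (Sum.inr 0)) : α ⊕ Fin (m + 1) → (α ⊕ Fin m) ⊕ Fin 1)
      convert this using 1
      all_goals
        ext z
        rcases z with z | z
        · rfl
        · refine Fin.lastCases ?_ (fun z => ?_) z <;> simp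
    intro xs ys h
    constructor
    · intro H y
      obtain ⟨x, hx⟩ := step h y
      exact (ih _ _ hx).1 (H x)
    · intro H x
      obtain ⟨y, hy⟩ := step h.symm x
      exact (ih _ _ hy.symm).2 (H y)

lemma formula_realize_iff_of_sameTerms (hK : IsDifferentiallyClosed K) {κ : Cardinal.{u}}
    (hκ : IsSaturated K κ) (hℵ : ℵ₀ < κ) {α : Type u} (hα : #α < κ) {v w : α → K}
    (h : SameTerms v w) (φ : diffRing.Formula α) : φ.Realize v ↔ φ.Realize w := by
  refine realize_iff_of_sameTerms hK hκ hℵ hα φ default default ?_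
  have := h.comp (Sum.elim id Fin.elim0 : α ⊕ Fin 0 → α)
  convert this using 1
  all_goals
    ext z
    rcases z with z | z
    · rfl
    · exact z.elim0

lemma tp_eq_iff_sameTerms (hK : IsDifferentiallyClosed K) {κ : Cardinal.{u}}
    (hκ : IsSaturated K κ) (hℵ : ℵ₀ < κ) {A : Set K} (hA : #A < κ) {n : ℕ} {a b : Fin n → K} :
    tp A a = tp A b ↔
      SameTerms (Sum.elim (↑) a : A ⊕ Fin n → K) (Sum.elim (↑) b : A ⊕ Fin n → K) := by
  rw [tp_eq_iff]
  constructor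
  · intro h t s
    have := h (t.equal s)
    rwa [Formula.realize_equal, Formula.realize_equal] at this
  · exact fun h φ => formula_realize_iff_of_sameTerms hK hκ hℵ (card_sum_fin_lt hℵ hA n) h φ

/-- The same for the parameter set given by the image of a small field. -/
lemma tp_range_eq_iff_sameTerms (hK : IsDifferentiallyClosed K) {κ : Cardinal.{u}}
    (hκ : IsSaturated K κ) (hℵ : ℵ₀ < κ) {ι : Type u} (hι : #ι < κ) (e : ι → K) {n : ℕ}
    {a b : Fin n → K} :
    tp (Set.range e) a = tp (Set.range e) b ↔ SameTerms (Sum.elim e a) (Sum.elim e b) := by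
  rw [tp_eq_iff_sameTerms hK hκ hℵ (Cardinal.mk_range_le.trans_lt hι)]
  constructor
  · intro h
    have := h.comp (Sum.map (Set.rangeFactorization e) id : ι ⊕ Fin n → _)
    convert this using 1
    all_goals
      ext z
      rcases z with z | z <;> rfl
  · intro h
    choose f hf using fun x : Set.range e => x.2
    have := h.comp (Sum.map f id : Set.range e ⊕ Fin n → _)
    convert this using 1
    all_goals
      ext z
      rcases z with z | z
      · exact (hf z).symm
      · rfl

end QuantifierElimination

end DVar

namespace DVar

open FirstOrder FirstOrder.Language MvPolynomial AffineVariety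

/-! ### The derivation on polynomials given by δx = s(x) -/

section PolynomialDerivations

variable {F : Type u} [Field F] [Differential F] {σ : Type v} [Fintype σ]

lemma coeff_coeffDeriv (f : MvPolynomial σ F) (m : σ →₀ ℕ) :
    (coeffDeriv f).coeff m = Differential.deriv (f.coeff m) := by
  classical
  simp only [coeffDeriv, coeff_sum, coeff_monomial, Finset.sum_ite_eq', mem_support_iff]
  split_ifs with h
  · rfl
  · rw [not_not] at h
    simp [h]

/-- `f ↦ f^δ` as a derivation. -/
noncomputable def coeffDerivation : Derivation ℤ (MvPolynomial σ F) (MvPolynomial σ F) :=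
  Derivation.mk' (AddMonoidHom.toIntLinearMap
    { toFun := coeffDeriv
      map_zero' := by ext m; simp [coeff_coeffDeriv]
      map_add' := fun f g => by ext m; simp [coeff_coeffDeriv] }) (by
    classical
    intro f g
    ext m
    change (coeffDeriv (f * g)).coeff m = (f * coeffDeriv g + g * coeffDeriv f).coeff m
    rw [mul_comm g, coeff_add, coeff_coeffDeriv, coeff_mul, coeff_mul, coeff_mul, map_sum,
      ← Finset.sum_add_distrib]
    refine Finset.sum_congr rfl fun p _ => ?_
    rw [Derivation.leibniz, coeff_coeffDeriv, coeff_coeffDeriv, smul_eq_mul, smul_eq_mul]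
    ring)

/-- The derivation of `F[x]` that extends that of `F` and sends `x_i` to `s_i`. -/
noncomputable def polyDeriv (s : σ → MvPolynomial σ F) :
    Derivation ℤ (MvPolynomial σ F) (MvPolynomial σ F) :=
  coeffDerivation + ∑ i, s i • (pderiv i : Derivation F _ _).restrictScalars ℤ

lemma polyDeriv_apply (s : σ → MvPolynomial σ F) (f : MvPolynomial σ F) :
    polyDeriv s f = coeffDeriv f + ∑ i, pderiv i f * s i := by
  change coeffDeriv f + Derivation.coeFnAddMonoidHom (∑ i, _) f = _
  rw [map_sum, Finset.sum_apply]
  congr 1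
  exact Finset.sum_congr rfl fun i _ => mul_comm _ _

lemma coeffDeriv_C (c : F) : coeffDeriv (C c : MvPolynomial σ F) = C (Differential.deriv c) := by
  classical
  ext m
  simp only [coeff_coeffDeriv, coeff_C]
  split_ifs <;> simp

lemma coeffDeriv_X (i : σ) : coeffDeriv (X i : MvPolynomial σ F) = 0 := by
  classical
  ext m
  rw [coeff_coeffDeriv, coeff_X, coeff_zero]
  split_ifs <;> simp

lemma polyDeriv_C (s : σ → MvPolynomial σ F) (c : F) :
    polyDeriv s (C c) = C (Differential.deriv c) := by
  simp [polyDeriv_apply, coeffDeriv_C]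

lemma polyDeriv_X (s : σ → MvPolynomial σ F) (i : σ) : polyDeriv s (X i) = s i := by
  classical
  simp [polyDeriv_apply, coeffDeriv_X, pderiv_X, Pi.single_apply]

/-- Both sides are additive in `f` and obey the product rule along `φ`, so constants and variables
suffice. -/
lemma map_polyDeriv {R : Type*} [CommRing R] (δ : Derivation ℤ R R) (s : σ → MvPolynomial σ F)
    (φ : MvPolynomial σ F →+* R) (hC : ∀ c, φ (C (Differential.deriv c)) = δ (φ (C c)))
    (hX : ∀ i, φ (s i) = δ (φ (X i))) (f : MvPolynomial σ F) : φ (polyDeriv s f) = δ (φ f) := by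
  induction f using MvPolynomial.induction_on with
  | C c => rw [polyDeriv_C, hC]
  | add p q hp hq => simp only [map_add, hp, hq]
  | mul_X p i hp =>
    rw [Derivation.leibniz, polyDeriv_X, map_mul, Derivation.leibniz]
    simp only [smul_eq_mul, map_add, map_mul, hp, hX]

lemma deriv_aeval {K : Type*} [Field K] [Differential K] [Algebra F K] [DifferentialAlgebra F K]
    (s : σ → MvPolynomial σ F) {a : σ → K} (ha : ∀ i, Differential.deriv (a i) = aeval a (s i))
    (f : MvPolynomial σ F) : aeval a (polyDeriv s f) = Differential.deriv (aeval a f) :=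
  map_polyDeriv Differential.deriv s (aeval a : MvPolynomial σ F →ₐ[F] K).toRingHom
    (fun c => by simp [DifferentialAlgebra.deriv_algebraMap]) (fun i => by simp [ha]) f

lemma map_polyDeriv_map {E : Type*} [Field E] [Differential E] [Algebra F E]
    [DifferentialAlgebra F E] (s : σ → MvPolynomial σ F) (f : MvPolynomial σ F) :
    map (algebraMap F E) (polyDeriv s f) =
      polyDeriv (fun i => map (algebraMap F E) (s i)) (map (algebraMap F E) f) :=
  map_polyDeriv (polyDeriv fun i => map (algebraMap F E) (s i)) s (map (algebraMap F E))
    (fun c => by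
      rw [map_C, map_C, ← DifferentialAlgebra.deriv_algebraMap (A := F) (B := E) c]
      exact (polyDeriv_C (fun i => map (algebraMap F E) (s i)) _).symm)
    (fun i => by
      rw [map_X]
      exact (polyDeriv_X (fun i => map (algebraMap F E) (s i)) i).symm) f

lemma polyDeriv_mem_map {E : Type*} [Field E] [Differential E] [Algebra F E]
    [DifferentialAlgebra F E] (s : σ → MvPolynomial σ F) {I : Ideal (MvPolynomial σ F)}
    (hI : ∀ f ∈ I, polyDeriv s f ∈ I) :
    ∀ f ∈ I.map (map (algebraMap F E)),
      polyDeriv (fun i => map (algebraMap F E) (s i)) f ∈ I.map (map (algebraMap F E)) := by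
  intro f hf
  refine Submodule.span_induction ?_ ?_ ?_ ?_ hf
  · rintro _ ⟨g, hg, rfl⟩
    rw [← map_polyDeriv_map]
    exact Ideal.mem_map_of_mem _ (hI g hg)
  · simp
  · intro x y _ _ hx hy
    rw [map_add]
    exact Ideal.add_mem _ hx hy
  · intro a x hx' hx
    rw [smul_eq_mul, Derivation.leibniz]
    exact Ideal.add_mem _ (Ideal.mul_mem_left _ _ hx) (by
      rw [smul_eq_mul, mul_comm]; exact Ideal.mul_mem_left _ _ hx')

lemma aeval_prolongPoly {A : Type*} [CommRing A] [Algebra F A] (a b : σ → A)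
    (f : MvPolynomial σ F) : aeval (Sum.elim a b) (prolongPoly f) =
      aeval a (coeffDeriv f) + ∑ i, aeval a (pderiv i f) * b i := by
  have h : (Sum.elim a b) ∘ Sum.inl = a := rfl
  simp [prolongPoly, aeval_rename, h]

end PolynomialDerivations

/-! ### D-points and generic D-points in equations -/

namespace DVariety

variable {k : Type u} [Field k] [Differential k] {σ : Type v} [Fintype σ] (X : DVariety k σ)

/-- Polynomials representing the `y` co-ordinates of the section. -/
noncomputable def sectionPoly (i : σ) : MvPolynomial σ k :=
  (Ideal.Quotient.mk_surjective (X.s.component (Sum.inr i))).choose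

lemma mk_sectionPoly (i : σ) :
    Ideal.Quotient.mk X.V.ideal (X.sectionPoly i) = X.s.component (Sum.inr i) :=
  (Ideal.Quotient.mk_surjective (X.s.component (Sum.inr i))).choose_spec

lemma component_eq : X.s.component = Sum.elim (fun i => Ideal.Quotient.mk X.V.ideal (MvPolynomial.X i))
    (fun i => Ideal.Quotient.mk X.V.ideal (X.sectionPoly i)) := by
  funext j
  rcases j with i | i
  · exact X.isSection i
  · exact (X.mk_sectionPoly i).symm

lemma aeval_mk (V : AffineVariety k σ) (f : MvPolynomial σ k) :
    aeval (fun i => Ideal.Quotient.mk V.ideal (MvPolynomial.X i)) f =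
      Ideal.Quotient.mk V.ideal f := by
  have : (aeval (fun i => Ideal.Quotient.mk V.ideal (MvPolynomial.X i)) :
      MvPolynomial σ k →ₐ[k] V.CoordRing) = Ideal.Quotient.mkₐ k V.ideal := by
    ext i
    simp
  exact DFunLike.congr_fun this f

/-- Substituting the section for the y co-ordinates turns the prolongation equation of `f` into the
derivation applied to `f`, and the section satisfies that equation on V. -/
lemma polyDeriv_mem {f : MvPolynomial σ k} (hf : f ∈ X.V.ideal) :
    polyDeriv X.sectionPoly f ∈ X.V.ideal := by
  have h := X.s.mapsTo (prolongPoly f)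
    (Ideal.le_radical (Ideal.subset_span (Or.inr ⟨f, hf, rfl⟩)))
  rw [component_eq, aeval_prolongPoly] at h
  simp only [aeval_mk] at h
  rw [← Ideal.Quotient.eq_zero_iff_mem, polyDeriv_apply, ← h]
  simp

section Points

variable {K : Type w} [Field K] [Differential K] [Algebra k K]

/-- Evaluation of regular functions on a point. -/
noncomputable def singletonEval (a : σ → K) : (AffineVariety.singleton a).CoordRing →ₐ[K] K :=
  Ideal.Quotient.liftₐ _ (aeval a) (fun _ h => h)

lemma singletonEval_mk (a : σ → K) (f : MvPolynomial σ K) :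
    singletonEval a (Ideal.Quotient.mk _ f) = aeval a f := rfl

lemma singletonEval_injective (a : σ → K) : Function.Injective (singletonEval a) := by
  rw [injective_iff_map_eq_zero]
  intro x
  obtain ⟨f, rfl⟩ := Ideal.Quotient.mk_surjective x
  exact fun h => Ideal.Quotient.eq_zero_iff_mem.2 h

lemma singletonEval_restrict (a : σ → K)
    (h : (AffineVariety.singleton a).IsSubvariety (X.V.baseChange K)) (f : MvPolynomial σ k) :
    singletonEval a (X.V.restrict _ h (Ideal.Quotient.mk _ f)) = aeval a f := by
  change singletonEval a (Ideal.Quotient.mk _ (map (algebraMap k K) f)) = _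
  rw [singletonEval_mk, aeval_map_algebraMap]

lemma singletonEval_component (a : σ → K)
    (h : (AffineVariety.singleton a).IsSubvariety (X.V.baseChange K)) :
    (fun j => singletonEval a (X.V.restrict _ h (X.s.component j))) =
      Sum.elim a (fun i => aeval a (X.sectionPoly i)) := by
  rw [component_eq]
  funext j
  rcases j with i | i
  · exact (X.singletonEval_restrict a h _).trans (aeval_X _ _)
  · exact X.singletonEval_restrict a h _

lemma isDPoint_iff (a : σ → K) : X.IsDPoint a ↔
    (∀ f ∈ X.V.ideal, aeval a f = 0) ∧
      ∀ i, Differential.deriv (a i) = aeval a (X.sectionPoly i) := by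
  classical
  constructor
  · rintro ⟨h, t, ht⟩
    refine ⟨fun f hf => ?_, fun i => ?_⟩
    · have : map (algebraMap k K) f ∈ (AffineVariety.singleton a).ideal :=
        h (Ideal.le_radical (Ideal.mem_map_of_mem _ hf))
      have : aeval a (map (algebraMap k K) f) = 0 := this
      rwa [aeval_map_algebraMap] at this
    · have h1 := t.mapsTo (prolongPoly (MvPolynomial.X i - C (a i)))
        (Ideal.le_radical (Ideal.subset_span (Or.inr ⟨_, by
          change aeval a _ = 0
          simp, rfl⟩)))
      have h2 := congrArg (singletonEval a) h1
      have h3 : t.component = fun j => X.V.restrict _ h (X.s.component j) := funext ht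
      rw [h3, map_zero, comp_aeval_apply] at h2
      change aeval (fun j => singletonEval a (X.V.restrict _ h (X.s.component j))) _ = 0 at h2
      rw [singletonEval_component, aeval_prolongPoly] at h2
      have h4 : coeffDeriv (MvPolynomial.X i - C (a i)) = -C (Differential.deriv (a i)) := by
        have := map_sub (coeffDerivation : Derivation ℤ (MvPolynomial σ K) (MvPolynomial σ K))
          (MvPolynomial.X i) (C (a i))
        change coeffDeriv (MvPolynomial.X i - C (a i)) = coeffDeriv (MvPolynomial.X i) -
          coeffDeriv (C (a i)) at this
        rw [this, coeffDeriv_X, coeffDeriv_C, zero_sub]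
      rw [h4] at h2
      simp [pderiv_X, Pi.single_apply] at h2
      rw [eq_comm, ← sub_eq_zero, ← h2]
      ring
  · rintro ⟨hV, hs⟩
    have h : (AffineVariety.singleton a).IsSubvariety (X.V.baseChange K) := by
      refine ((AffineVariety.singleton a).isRadical.radical_le_iff).2 (Ideal.map_le_iff_le_comap.2 ?_)
      intro f hf
      change aeval a (map (algebraMap k K) f) = 0
      rw [aeval_map_algebraMap, hV f hf]
    refine ⟨h, ⟨fun j => X.V.restrict _ h (X.s.component j), fun g hg => ?_⟩, fun j => rfl⟩
    refine singletonEval_injective a ?_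
    rw [map_zero, comp_aeval_apply]
    change aeval (fun j => singletonEval a (X.V.restrict _ h (X.s.component j))) _ = 0
    rw [singletonEval_component]
    have hker : (AffineVariety.singleton a).prolongation.ideal ≤
        RingHom.ker (aeval (Sum.elim a fun i => aeval a (X.sectionPoly i)) :
          MvPolynomial (σ ⊕ σ) K →ₐ[K] K) := by
      refine ((RingHom.ker_isPrime _).isRadical.radical_le_iff).2 (Ideal.span_le.2 ?_)
      rintro _ (⟨f, hf, rfl⟩ | ⟨f, hf, rfl⟩)
      · have hf : aeval a f = 0 := hf
        change aeval _ (rename Sum.inl f) = 0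
        rw [aeval_rename]
        exact hf
      · have hf : aeval a f = 0 := hf
        change aeval _ (prolongPoly f) = 0
        -- The chain rule for f(a) = 0, taking the constants δ(a_i) as the right-hand sides.
        have h1 := deriv_aeval (fun i => C (Differential.deriv (a i))) (a := a)
          (fun i => by simp) f
        rw [hf, map_zero, polyDeriv_apply] at h1
        rw [aeval_prolongPoly, ← h1]
        simp only [map_add, map_sum, map_mul, hs, aeval_C, Algebra.algebraMap_self,
          RingHom.id_apply]
    exact hker hg

/-- The kernel of evaluation at `a` is the ideal of the smallest variety over `k` through `a`. Lying
in no proper subvariety means that this locus is all of V. -/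
lemma isGenericDPoint_iff (a : σ → K) : X.IsGenericDPoint a ↔
    (∀ i, Differential.deriv (a i) = aeval a (X.sectionPoly i)) ∧
      RingHom.ker (aeval a : MvPolynomial σ k →ₐ[k] K) = X.V.ideal := by
  rw [IsGenericDPoint, isDPoint_iff]
  constructor
  · rintro ⟨⟨h1, h2⟩, h3⟩
    refine ⟨h2, ?_⟩
    let W : AffineVariety k σ := ⟨RingHom.ker (aeval a : MvPolynomial σ k →ₐ[k] K),
      (RingHom.ker_isPrime _).isRadical⟩
    by_contra hne
    exact h3 W h1 (fun h => hne (congrArg AffineVariety.ideal h)) (fun f hf => hf)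
  · rintro ⟨h1, h2⟩
    refine ⟨⟨fun f hf => ?_, h1⟩, fun W hW hne ha => hne ?_⟩
    · rw [← h2] at hf
      exact hf
    · refine AffineVariety.ext (le_antisymm (fun f hf => ?_) hW)
      rw [← h2]
      exact ha f hf

end Points

end DVariety

/-! ### Types of solutions and prime differential ideals -/

section Realization

variable {K : Type u} [Field K] [Differential K] {F : Type u} [Field F] [Differential F]
  [Algebra F K] [DifferentialAlgebra F K] {n : ℕ}

/-- Every polynomial is the value of a term at its coefficients and the variables. -/
lemma exists_term (f : MvPolynomial (Fin n) F) : ∃ t : diffRing.Term (F ⊕ Fin n),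
    ∀ {R : Type u} [CommRing R] [Differential R] (φ : MvPolynomial (Fin n) F →+* R),
      t.realize (Sum.elim (fun c => φ (C c)) (fun i => φ (X i))) = φ f := by
  induction f using MvPolynomial.induction_on with
  | C c => exact ⟨Term.var (Sum.inl c), fun φ => rfl⟩
  | add p q hp hq =>
    obtain ⟨t, ht⟩ := hp
    obtain ⟨s, hs⟩ := hq
    exact ⟨termAdd t s, fun φ => by rw [realize_termAdd, ht, hs, map_add]⟩
  | mul_X p i hp =>
    obtain ⟨t, ht⟩ := hp
    exact ⟨termMul t (Term.var (Sum.inr i)), fun φ => by rw [realize_termMul, ht, map_mul]; rfl⟩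

/-- Equalities of terms at `(C, X)` in two quotients of `F[x]`, read off polynomials. -/
lemma SameTerms.poly_iff {R S : Type u} [CommRing R] [Differential R] [CommRing S]
    [Differential S] {φ : MvPolynomial (Fin n) F →+* R} {ψ : MvPolynomial (Fin n) F →+* S}
    (h : SameTerms (Sum.elim (fun c => φ (C c)) (fun i => φ (X i)))
      (Sum.elim (fun c => ψ (C c)) (fun i => ψ (X i)))) :
    RingHom.ker φ = RingHom.ker ψ ∧ ∀ i (f : MvPolynomial (Fin n) F),
      Differential.deriv (φ (X i)) = φ f ↔ Differential.deriv (ψ (X i)) = ψ f := by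
  constructor
  · ext f
    obtain ⟨t, ht⟩ := exists_term f
    have := h t termZero
    rw [ht, ht] at this
    exact this
  · intro i f
    obtain ⟨t, ht⟩ := exists_term f
    have := h (termDeriv (Term.var (Sum.inr i))) t
    rw [ht, ht] at this
    exact this

lemma elim_aeval (a : Fin n → K) :
    (Sum.elim (fun c : F => (aeval a : MvPolynomial (Fin n) F →ₐ[F] K).toRingHom (C c))
      (fun i => (aeval a : MvPolynomial (Fin n) F →ₐ[F] K).toRingHom (X i)) : F ⊕ Fin n → K) =
      Sum.elim (algebraMap F K) a := by
  ext z
  rcases z with z | z <;> simp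

/-- On F[x] with the derivation given by `s`, both evaluations are differential homomorphisms, so
the kernel decides equality of all differential terms. In the other direction polynomials and the
equations δx = s(x) are themselves expressed by terms. -/
lemma sameTerms_iff_ker_eq (s : Fin n → MvPolynomial (Fin n) F) {a b : Fin n → K}
    (ha : ∀ i, Differential.deriv (a i) = aeval a (s i)) :
    SameTerms (Sum.elim (algebraMap F K) a) (Sum.elim (algebraMap F K) b) ↔
      (∀ i, Differential.deriv (b i) = aeval b (s i)) ∧
      RingHom.ker (aeval a : MvPolynomial (Fin n) F →ₐ[F] K) =
        RingHom.ker (aeval b : MvPolynomial (Fin n) F →ₐ[F] K) := by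
  rw [← elim_aeval (F := F) a, ← elim_aeval (F := F) b]
  constructor
  · intro h
    obtain ⟨h1, h2⟩ := h.poly_iff
    exact ⟨fun i => by simpa using (h2 i (s i)).1 (by simpa using ha i), h1⟩
  · rintro ⟨hb, h⟩
    let _ : Differential (MvPolynomial (Fin n) F) := ⟨polyDeriv s⟩
    have := sameTerms_of_ker_eq (aeval a : MvPolynomial (Fin n) F →ₐ[F] K).toRingHom
      (aeval b : MvPolynomial (Fin n) F →ₐ[F] K).toRingHom (deriv_aeval s ha) (deriv_aeval s hb) h
      (Sum.elim C X)
    convert this using 1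
    all_goals
      ext z
      rcases z with z | z <;> rfl

/-- Every prime differential ideal of `F[x]` is the ideal of a solution in `K` of the equations
`δ x_i = s_i`. -/
lemma exists_point (hK : IsDifferentiallyClosed K) {κ : Cardinal.{u}} (hκ : IsSaturated K κ)
    (hF : #F < κ) (s : Fin n → MvPolynomial (Fin n) F) (P : Ideal (MvPolynomial (Fin n) F))
    [P.IsPrime] (hP : ∀ f ∈ P, polyDeriv s f ∈ P) :
    ∃ a : Fin n → K, (∀ i, Differential.deriv (a i) = aeval a (s i)) ∧
      RingHom.ker (aeval a : MvPolynomial (Fin n) F →ₐ[F] K) = P := by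
  let _ : Differential (MvPolynomial (Fin n) F ⧸ P) := ⟨quotientDeriv (polyDeriv s) P hP⟩
  have h0 : SameTerms (algebraMap F K) (fun c => Ideal.Quotient.mk P (C c)) := by
    have h1 := sameTerms_map (algebraMap F K)
      (fun x => (DifferentialAlgebra.deriv_algebraMap x).symm) (algebraMap F K).injective id
    have h2 := sameTerms_map ((Ideal.Quotient.mk P).comp C)
      (fun x => by
        change Ideal.Quotient.mk P (C _) = Ideal.Quotient.mk P (polyDeriv s (C x))
        rw [polyDeriv_C]) ((Ideal.Quotient.mk P).comp C).injective id
    exact fun t s => (h1 t s).symm.trans (h2 t s)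
  -- The images of the variables form a solution in the differential domain F[x]/P, which is copied
  -- into `K` over `F`.
  obtain ⟨a, ha⟩ := h0.exists_extend hK hκ hF (fun i => Ideal.Quotient.mk P (X i))
  rw [← elim_aeval (F := F) a] at ha
  obtain ⟨h1, h2⟩ := ha.poly_iff (φ := (aeval a : MvPolynomial (Fin n) F →ₐ[F] K).toRingHom)
    (ψ := Ideal.Quotient.mk P)
  refine ⟨a, fun i => ?_, h1.trans (Ideal.mk_ker)⟩
  have := (h2 i (s i)).2 (by
    change Ideal.Quotient.mk P (polyDeriv s (X i)) = _
    rw [polyDeriv_X])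
  simpa using this

end Realization

end DVar

namespace DVar

open MvPolynomial

/-! ### Ideals under extension of coefficients -/

section ScalarExtension

variable {k : Type*} [Field k] {F : Type*} [Field F] [Algebra k F] {σ : Type*}

/-- A linear functional applied to the coefficients of a polynomial. -/
noncomputable def coeffMap (l : F →ₗ[k] k) (f : MvPolynomial σ F) : MvPolynomial σ k :=
  ∑ m ∈ f.support, monomial m (l (f.coeff m))

lemma coeff_coeffMap (l : F →ₗ[k] k) (f : MvPolynomial σ F) (m : σ →₀ ℕ) :
    (coeffMap l f).coeff m = l (f.coeff m) := by
  classical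
  simp only [coeffMap, coeff_sum, coeff_monomial, Finset.sum_ite_eq', mem_support_iff]
  split_ifs with h
  · rfl
  · rw [not_not] at h
    simp [h]

lemma coeffMap_add (l : F →ₗ[k] k) (f g : MvPolynomial σ F) :
    coeffMap l (f + g) = coeffMap l f + coeffMap l g := by
  ext m
  simp [coeff_coeffMap]

lemma coeffMap_zero (l : F →ₗ[k] k) : coeffMap l (0 : MvPolynomial σ F) = 0 := by
  ext m
  simp [coeff_coeffMap]

lemma coeffMap_monomial (l : F →ₗ[k] k) (m : σ →₀ ℕ) (c : F) :
    coeffMap l (monomial m c) = monomial m (l c) := by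
  classical
  ext m'
  rw [coeff_coeffMap, coeff_monomial, coeff_monomial]
  split_ifs <;> simp

lemma coeffMap_rename {τ : Type*} (l : F →ₗ[k] k) (e : σ → τ) (f : MvPolynomial σ F) :
    coeffMap l (rename e f) = rename e (coeffMap l f) := by
  induction f using MvPolynomial.induction_on' with
  | monomial m c => simp only [rename_monomial, coeffMap_monomial]
  | add p q hp hq => rw [map_add, coeffMap_add, coeffMap_add, map_add, hp, hq]

lemma coeffMap_map_mul (l : F →ₗ[k] k) (p : MvPolynomial σ k) (f : MvPolynomial σ F) :
    coeffMap l (map (algebraMap k F) p * f) = p * coeffMap l f := by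
  classical
  ext m
  rw [coeff_coeffMap, coeff_mul, coeff_mul, map_sum]
  refine Finset.sum_congr rfl fun x _ => ?_
  rw [coeff_map, coeff_coeffMap, ← Algebra.smul_def, map_smul, smul_eq_mul]

lemma coeffMap_mem {l : F →ₗ[k] k} {I : Ideal (MvPolynomial σ k)} {f : MvPolynomial σ F}
    (hf : f ∈ I.map (map (algebraMap k F))) : coeffMap l f ∈ I := by
  -- The map is not linear over F[x], so the induction carries all multiples of `f` along.
  suffices ∀ g, coeffMap l (g * f) ∈ I by simpa using this 1
  refine Submodule.span_induction ?_ ?_ ?_ ?_ hf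
  · rintro _ ⟨p, hp, rfl⟩ g
    rw [mul_comm, coeffMap_map_mul]
    exact I.mul_mem_right _ hp
  · intro g
    simp [coeffMap_zero]
  · intro x y _ _ hx hy g
    rw [mul_add, coeffMap_add]
    exact I.add_mem (hx g) (hy g)
  · intro a x _ hx g
    rw [smul_eq_mul, ← mul_assoc]
    exact hx _

/-- The expansion of a polynomial in a basis of the coefficient field. -/
lemma exists_eq_sum_coeffMap {ι : Type*} (b : Module.Basis ι k F) (f : MvPolynomial σ F) :
    ∃ J : Finset ι, f = ∑ j ∈ J, C (b j) * map (algebraMap k F) (coeffMap (b.coord j) f) := by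
  classical
  refine ⟨f.support.biUnion fun m => (b.repr (f.coeff m)).support, ?_⟩
  ext m
  simp only [coeff_sum, coeff_C_mul, coeff_map, coeff_coeffMap, Module.Basis.coord_apply]
  by_cases hm : m ∈ f.support
  · rw [← Finset.sum_subset (Finset.subset_biUnion_of_mem
      (fun m => (b.repr (f.coeff m)).support) hm)]
    · conv_lhs => rw [← b.linearCombination_repr (f.coeff m), Finsupp.linearCombination_apply,
        Finsupp.sum]
      refine Finset.sum_congr rfl fun j _ => ?_
      rw [Algebra.smul_def, mul_comm]
    · intro j _ hj
      rw [Finsupp.notMem_support_iff.1 hj]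
      simp
  · rw [notMem_support_iff.1 hm]
    simp

/-- In a k-basis of F the components of `f` are its images under the co-ordinate functionals.
Questions about the extended ideal are thereby reduced to `k`. -/
lemma mem_map_iff_coeffMap_mem {I : Ideal (MvPolynomial σ k)} {f : MvPolynomial σ F} :
    f ∈ I.map (map (algebraMap k F)) ↔ ∀ l : F →ₗ[k] k, coeffMap l f ∈ I := by
  refine ⟨fun h l => coeffMap_mem h, fun h => ?_⟩
  obtain ⟨J, hJ⟩ := exists_eq_sum_coeffMap (Module.Basis.ofVectorSpace k F) f
  rw [hJ]
  exact Ideal.sum_mem _ fun j _ => Ideal.mul_mem_left _ _ (Ideal.mem_map_of_mem _ (h _))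

lemma map_mem_map_iff {I : Ideal (MvPolynomial σ k)} {f : MvPolynomial σ k} :
    map (algebraMap k F) f ∈ I.map (map (algebraMap k F)) ↔ f ∈ I := by
  refine ⟨fun h => ?_, Ideal.mem_map_of_mem _⟩
  obtain ⟨l, hl⟩ := (Algebra.linearMap k F).exists_leftInverse_of_injective
    (LinearMap.ker_eq_bot.2 (algebraMap k F).injective)
  have : coeffMap l (map (algebraMap k F) f) = f := by
    ext m
    rw [coeff_coeffMap, coeff_map]
    exact LinearMap.congr_fun hl _
  rw [← this]
  exact coeffMap_mem h

/-- Elements outside a prime ideal stay regular after extension of the coefficients. -/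
lemma mem_map_of_map_mul_mem {I : Ideal (MvPolynomial σ k)} [I.IsPrime] {p : MvPolynomial σ k}
    (hp : p ∉ I) {f : MvPolynomial σ F}
    (h : map (algebraMap k F) p * f ∈ I.map (map (algebraMap k F))) :
    f ∈ I.map (map (algebraMap k F)) := by
  rw [mem_map_iff_coeffMap_mem] at h ⊢
  intro l
  have := h l
  rw [coeffMap_map_mul] at this
  exact (Ideal.IsPrime.mem_or_mem ‹_› this).resolve_left hp

lemma comap_radical_map {I : Ideal (MvPolynomial σ k)} (hI : I.IsRadical) :
    ((I.map (map (algebraMap k F))).radical).comap (map (algebraMap k F)) = I := by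
  refine le_antisymm ?_ (Ideal.map_le_iff_le_comap.1 Ideal.le_radical)
  rintro f ⟨m, hm⟩
  rw [← map_pow, map_mem_map_iff] at hm
  exact hI ⟨m, hm⟩

/-- Over an algebraically closed field, prime ideals stay prime under extension of the
coefficients. -/
lemma isPrime_map_of_isAlgClosed [IsAlgClosed k] [Finite σ] (P : Ideal (MvPolynomial σ k))
    [P.IsPrime] : (P.map (map (algebraMap k F))).IsPrime := by
  constructor
  · rw [Ideal.ne_top_iff_one, ← map_one (map (algebraMap k F)), map_mem_map_iff]
    exact (Ideal.ne_top_iff_one P).1 (Ideal.IsPrime.ne_top ‹_›)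
  · intro f g hfg
    by_contra! h
    rw [mem_map_iff_coeffMap_mem, mem_map_iff_coeffMap_mem] at h
    push Not at h
    obtain ⟨⟨l, hl⟩, ⟨l', hl'⟩⟩ := h
    have hmul : coeffMap l f * coeffMap l' g ∉ P := fun h =>
      (Ideal.IsPrime.mem_or_mem ‹_› h).elim hl hl'
    -- By the Nullstellensatz some k-point `x` of `P` witnesses that the product is not in `P`.
    -- Evaluation at a k-point commutes with functionals on F, so f(x) and g(x) are both nonzero in
    -- F, although their product vanishes.
    rw [← MvPolynomial.IsPrime.vanishingIdeal_zeroLocus (K := k) P] at hmul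
    rw [mem_vanishingIdeal_iff] at hmul
    push Not at hmul
    obtain ⟨x, hx, hne⟩ := hmul
    have hev : ∀ (l : F →ₗ[k] k) (f : MvPolynomial σ F),
        aeval x (coeffMap l f) = l (aeval (fun i => algebraMap k F (x i)) f) := by
      intro l f
      induction f using MvPolynomial.induction_on' with
      | monomial m c =>
        rw [coeffMap_monomial, aeval_monomial, aeval_monomial]
        simp only [Finsupp.prod, ← map_pow, ← map_prod, Algebra.algebraMap_self, RingHom.id_apply]
        rw [mul_comm, mul_comm c, ← Algebra.smul_def, map_smul, smul_eq_mul]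
      | add p q hp hq => rw [coeffMap_add, map_add, hp, hq, map_add, map_add]
    have h0 : aeval (fun i => algebraMap k F (x i)) (f * g) = 0 := by
      have hle : P.map (map (algebraMap k F)) ≤
          RingHom.ker (aeval (fun i => algebraMap k F (x i)) : MvPolynomial σ F →ₐ[F] F) := by
        refine Ideal.map_le_iff_le_comap.2 fun p hp => ?_
        change aeval _ (map (algebraMap k F) p) = 0
        rw [aeval_map_algebraMap]
        exact (aeval_algebraMap_apply F x p).trans (by rw [hx p hp, map_zero])
      exact hle hfg
    rw [map_mul, hev, hev] at hne
    rw [map_mul, mul_eq_zero] at h0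
    rcases h0 with h0 | h0
    · exact hne (by rw [h0, map_zero, zero_mul])
    · exact hne (by rw [h0, map_zero, mul_zero])

end ScalarExtension

/-! ### Testing absolute irreducibility over an algebraic closure -/

section AbsoluteIrreducibility

variable {k : Type u} [Field k] {σ : Type v} [Finite σ]

/-- A variety is absolutely irreducible if it is irreducible over an algebraically closed algebraic
extension of the base field. -/
lemma AffineVariety.isAbsolutelyIrreducible_of_isAlgClosed (V : AffineVariety k σ) {F : Type w}
    [Field F] [Algebra k F] [Algebra.IsAlgebraic k F] [IsAlgClosed F]
    (h : (V.baseChange F).IsIrreducible) : V.IsAbsolutelyIrreducible := by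
  intro L _ _
  -- Both F and L sit inside E. The ideal is prime over E because it comes from F, and contracting
  -- it to L gives the ideal of V_L.
  let E := AlgebraicClosure L
  let i : F →ₐ[k] E := IsAlgClosed.lift
  let _ : Algebra F E := i.toAlgebra
  have : IsScalarTower k F E := IsScalarTower.of_algebraMap_eq fun x => (i.commutes x).symm
  let P : Ideal (MvPolynomial σ F) := (V.ideal.map (map (algebraMap k F))).radical
  have hP : P.IsPrime := h
  have hPE := isPrime_map_of_isAlgClosed (F := E) P
  have hmap : ∀ (f : MvPolynomial σ k), map (algebraMap F E) (map (algebraMap k F) f) =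
      map (algebraMap L E) (map (algebraMap k L) f) := by
    intro f
    rw [map_map, map_map, ← IsScalarTower.algebraMap_eq, ← IsScalarTower.algebraMap_eq]
  have hrad : P.map (map (algebraMap F E)) =
      ((V.ideal.map (map (algebraMap k L))).map (map (algebraMap L E))).radical := by
    apply le_antisymm
    · refine Ideal.map_le_iff_le_comap.2 ?_
      rintro f ⟨m, hm⟩
      refine ⟨m, ?_⟩
      rw [← map_pow]
      refine (Ideal.map_le_iff_le_comap.2 (Ideal.map_le_iff_le_comap.2 fun p hp => ?_) :
        (V.ideal.map (map (algebraMap k F))).map (map (algebraMap F E)) ≤ _)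
        (Ideal.mem_map_of_mem _ hm)
      rw [Ideal.mem_comap, Ideal.mem_comap, hmap]
      exact Ideal.mem_map_of_mem _ (Ideal.mem_map_of_mem _ hp)
    · rw [hPE.isRadical.radical_le_iff]
      refine Ideal.map_le_iff_le_comap.2 (Ideal.map_le_iff_le_comap.2 fun f hf => ?_)
      rw [Ideal.mem_comap, Ideal.mem_comap, ← hmap]
      exact Ideal.mem_map_of_mem _ (Ideal.le_radical (Ideal.mem_map_of_mem _ hf))
  have hcomap : (V.baseChange L).ideal = (P.map (map (algebraMap F E))).comap
      (map (algebraMap L E)) := by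
    rw [hrad]
    ext f
    constructor
    · rintro ⟨m, hm⟩
      exact ⟨m, by rw [← map_pow]; exact Ideal.mem_map_of_mem _ hm⟩
    · rintro ⟨m, hm⟩
      rw [← map_pow, map_mem_map_iff] at hm
      exact ⟨m, hm⟩
  change (V.baseChange L).ideal.IsPrime
  rw [hcomap]
  exact Ideal.IsPrime.comap _

end AbsoluteIrreducibility

end DVar

namespace DVar

open MvPolynomial

/-! ### Transcendence degree over a larger field -/

section TranscendenceDegree

/-- If `V` is algebraic over `k[y]`, then a domain generated over `F ⊇ k` by a copy of `V` is
algebraic over `F[y]`. -/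
lemma isAlgebraic_adjoin_of_algHom {k F V B : Type*} [Field k] [Field F] [Algebra k F]
    [CommRing V] [Algebra k V] [CommRing B] [IsDomain B] [Algebra F B] [Algebra k B]
    [IsScalarTower k F B] (ψ : V →ₐ[k] B) (hψ : Function.Injective ψ) {σ ι : Type*} (x : σ → V)
    (hx : Algebra.adjoin F (Set.range (ψ ∘ x)) = ⊤) (y : ι → V)
    [Algebra.IsAlgebraic (Algebra.adjoin k (Set.range y)) V] :
    Algebra.IsAlgebraic (Algebra.adjoin F (Set.range (ψ ∘ y))) B := by
  let C := Algebra.adjoin F (Set.range (ψ ∘ y))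
  have hC : ∀ z : Algebra.adjoin k (Set.range y), ψ z ∈ C.restrictScalars k := by
    intro z
    have : Algebra.adjoin k (Set.range y) ≤ (C.restrictScalars k).comap ψ := by
      refine Algebra.adjoin_le ?_
      rintro _ ⟨i, rfl⟩
      exact Algebra.subset_adjoin (R := F) ⟨i, rfl⟩
    exact this z.2
  let f : Algebra.adjoin k (Set.range y) →+* C :=
    ((ψ.comp (Algebra.adjoin k (Set.range y)).val).codRestrict (C.restrictScalars k) hC).toRingHom
  have hf : Function.Injective f := fun a b hab =>
    Subtype.ext (hψ (congrArg Subtype.val hab))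
  have halg : ∀ v : V, IsAlgebraic C (ψ v) := fun v =>
    (Algebra.IsAlgebraic.isAlgebraic (R := Algebra.adjoin k (Set.range y)) v).ringHom_of_comp_eq
      f ψ.toRingHom hf (RingHom.ext fun _ => rfl)
  have hle : Algebra.adjoin F (Set.range (ψ ∘ x)) ≤
      (Subalgebra.algebraicClosure C B).restrictScalars F := by
    refine Algebra.adjoin_le ?_
    rintro _ ⟨i, rfl⟩
    exact halg (x i)
  rw [hx] at hle
  exact ⟨fun b => hle (Algebra.mem_top (x := b))⟩

open scoped IntermediateField.algebraAdjoinAdjoin in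
lemma trdeg_intermediateField_adjoin {F K : Type u} [Field F] [Field K] [Algebra F K] (S : Set K) :
    Algebra.trdeg F (IntermediateField.adjoin F S) = Algebra.trdeg F (Algebra.adjoin F S) := by
  rw [← trdeg_add_eq F (Algebra.adjoin F S) (A := IntermediateField.adjoin F S),
    trdeg_eq_zero (R := Algebra.adjoin F S) (A := IntermediateField.adjoin F S), add_zero]

/-- The transcendence degree of `F(a)` equals that of `k(a)` if and only if a transcendence basis
stays independent over `F`. -/
lemma trdeg_adjoin_eq_iff {k F K V : Type u} [Field k] [Field F] [Field K] [Algebra k F]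
    [Algebra F K] [Algebra k K] [IsScalarTower k F K] [CommRing V] [Algebra k V] (ψ : V →ₐ[k] K)
    (hψ : Function.Injective ψ) {σ : Type*} {ι : Type u} [Finite ι] (x : σ → V)
    (hx : Algebra.adjoin k (Set.range x) = ⊤) (y : ι → V)
    [Algebra.IsAlgebraic (Algebra.adjoin k (Set.range y)) V] :
    Algebra.trdeg F (IntermediateField.adjoin F (Set.range (ψ ∘ x))) = #ι ↔
      AlgebraicIndependent F (ψ ∘ y) := by
  let B := Algebra.adjoin F (Set.range (ψ ∘ x))
  let E := IntermediateField.adjoin F (Set.range (ψ ∘ x))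
  have hB : ∀ z, ψ z ∈ B.restrictScalars k := by
    intro z
    have : Algebra.adjoin k (Set.range x) ≤ (B.restrictScalars k).comap ψ := by
      refine Algebra.adjoin_le ?_
      rintro _ ⟨i, rfl⟩
      exact Algebra.subset_adjoin (R := F) ⟨i, rfl⟩
    rw [hx] at this
    exact this Algebra.mem_top
  let ψB : V →ₐ[k] B := ψ.codRestrict (B.restrictScalars k) hB
  have hψB : Function.Injective ψB := fun a b hab => hψ (congrArg Subtype.val hab)
  have hgen : Algebra.adjoin F (Set.range (ψB ∘ x)) = ⊤ := by
    have := Algebra.adjoin_adjoin_coe_preimage (R := F) (s := Set.range (ψ ∘ x))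
    convert this using 2
    ext b
    simp only [Set.mem_range, Set.mem_preimage, Function.comp_apply]
    exact exists_congr fun i => Subtype.ext_iff
  have halg : Algebra.IsAlgebraic (Algebra.adjoin F (Set.range (ψB ∘ y))) B :=
    isAlgebraic_adjoin_of_algHom ψB hψB x hgen y
  have hfrac : Algebra.trdeg F E = Algebra.trdeg F B := trdeg_intermediateField_adjoin _
  change Algebra.trdeg F E = _ ↔ _
  rw [hfrac]
  have hval : AlgebraicIndependent F (ψB ∘ y) ↔ AlgebraicIndependent F (ψ ∘ y) :=
    (AlgHom.algebraicIndependent_iff B.val Subtype.val_injective).symm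
  rw [← hval]
  constructor
  · intro h
    -- `B` is algebraic over F[y]. A finite such family with no more members than the transcendence
    -- degree has none to spare, so it is a basis.
    exact (Algebra.IsAlgebraic.isTranscendenceBasis_of_le_trdeg_of_finite F (ψB ∘ y) h.ge).1
  · intro h
    exact (h.isTranscendenceBasis_iff_isAlgebraic.2 halg).cardinalMk_eq_trdeg.symm

end TranscendenceDegree

/-! ### Transcendence bases among the co-ordinates -/

section Coordinates

variable {k : Type u} [Field k] {σ : Type} [Finite σ] (I : Ideal (MvPolynomial σ k))

lemma adjoin_mk_X : Algebra.adjoin k (Set.range fun i => Ideal.Quotient.mk I (X i)) = ⊤ := by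
  have h := Algebra.map_top (Ideal.Quotient.mkₐ k I)
  rw [← MvPolynomial.adjoin_range_X, AlgHom.map_adjoin, ← Set.range_comp,
    (AlgHom.range_eq_top _).2 (Ideal.Quotient.mkₐ_surjective k I)] at h
  exact h

/-- Some of the co-ordinate functions form a transcendence basis. -/
lemma exists_isTranscendenceBasis_coord [I.IsPrime] : ∃ (ι : Type u) (_ : Finite ι) (e : ι → σ),
    IsTranscendenceBasis k fun j => Ideal.Quotient.mk I (X (e j)) := by
  have : Algebra.IsAlgebraic
      (Algebra.adjoin k (Set.range fun i => Ideal.Quotient.mk I (X i)))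
      (MvPolynomial σ k ⧸ I) := by
    rw [adjoin_mk_X]
    exact ⟨fun x => isAlgebraic_algebraMap (⟨x, Algebra.mem_top⟩ :
      (⊤ : Subalgebra k (MvPolynomial σ k ⧸ I)))⟩
  have : FaithfulSMul k (MvPolynomial σ k ⧸ I) :=
    (faithfulSMul_iff_algebraMap_injective k _).2 (algebraMap k (MvPolynomial σ k ⧸ I)).injective
  obtain ⟨t, ht, hbasis⟩ := exists_isTranscendenceBasis_subset (R := k)
    (Set.range fun i => Ideal.Quotient.mk I (X i))
  choose e he using fun x : t => ht x.2
  refine ⟨t, ((Set.finite_range _).subset ht).to_subtype, e, ?_⟩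
  convert hbasis using 1
  exact _root_.funext he

variable {F : Type u} [Field F] [Algebra k F] {K : Type u} [Field K] [Algebra F K] [Algebra k K]
  [IsScalarTower k F K]

lemma aeval_X_eq_map (f : MvPolynomial σ k) :
    aeval (X : σ → MvPolynomial σ F) f = map (algebraMap k F) f := by
  rw [← aeval_map_algebraMap F, aeval_X_left_apply]

/-- A zero of `Q` whose independent co-ordinates stay independent over `F` is generic in the
variety of `Q`. -/
lemma ker_aeval_eq_of_algebraicIndependent {Q : Ideal (MvPolynomial σ F)} [Q.IsPrime]
    (hQ : Q.comap (map (algebraMap k F)) = I) {ι : Type u} (e : ι → σ)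
    (he : IsTranscendenceBasis k fun j => Ideal.Quotient.mk I (X (e j))) {a : σ → K}
    (hQa : Q ≤ RingHom.ker (aeval a : MvPolynomial σ F →ₐ[F] K))
    (ha : AlgebraicIndependent F (a ∘ e)) :
    RingHom.ker (aeval a : MvPolynomial σ F →ₐ[F] K) = Q := by
  have : I.IsPrime := hQ ▸ Ideal.IsPrime.comap _
  refine le_antisymm (fun f hf => ?_) hQa
  by_contra hfQ
  let ψ : (MvPolynomial σ k ⧸ I) →ₐ[k] (MvPolynomial σ F ⧸ Q) :=
    Ideal.Quotient.liftₐ I ((Ideal.Quotient.mkₐ k Q).comp (aeval X)) (fun g hg => by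
      rw [← hQ, Ideal.mem_comap, ← aeval_X_eq_map] at hg
      exact Ideal.Quotient.eq_zero_iff_mem.2 hg)
  have hψ : Function.Injective ψ := by
    rw [injective_iff_map_eq_zero]
    intro z
    obtain ⟨g, rfl⟩ := Ideal.Quotient.mk_surjective z
    intro h
    refine Ideal.Quotient.eq_zero_iff_mem.2 ?_
    rw [← hQ, Ideal.mem_comap, ← aeval_X_eq_map]
    exact Ideal.Quotient.eq_zero_iff_mem.1 h
  have hψX : ∀ i, ψ (Ideal.Quotient.mk I (X i)) = Ideal.Quotient.mk Q (X i) := by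
    intro i
    change Ideal.Quotient.mk Q (aeval X (X i)) = _
    rw [aeval_X]
  have := he.isAlgebraic
  have halg := isAlgebraic_adjoin_of_algHom (F := F) ψ hψ
    (fun i => Ideal.Quotient.mk I (X i)) (by
      rw [show (ψ ∘ fun i => Ideal.Quotient.mk I (X i)) = fun i => Ideal.Quotient.mk Q (X i) from
        _root_.funext hψX]
      exact adjoin_mk_X Q) (fun j => Ideal.Quotient.mk I (X (e j)))
  have hy : (ψ ∘ fun j => Ideal.Quotient.mk I (X (e j))) =
      fun j => Ideal.Quotient.mk Q (X (e j)) := _root_.funext fun j => hψX (e j)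
  rw [hy] at halg
  have hf0 : Ideal.Quotient.mk Q f ≠ 0 := fun h => hfQ (Ideal.Quotient.eq_zero_iff_mem.1 h)
  -- Being nonzero and algebraic, `f` modulo `Q` divides a nonzero polynomial `c` in the basis
  -- co-ordinates. As `f` vanishes at `a`, so does `c`, against the independence of `a ∘ e`.
  obtain ⟨r, hr, hdvd⟩ := (halg.1 (Ideal.Quotient.mk Q f)).exists_nonzero_dvd
    (mem_nonZeroDivisors_of_ne_zero hf0)
  obtain ⟨r, hr'⟩ := r
  have hr'' := hr'
  rw [Algebra.adjoin_range_eq_range_aeval] at hr''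
  obtain ⟨c, hc⟩ := hr''
  have hc : aeval (fun j => Ideal.Quotient.mk Q (X (e j))) c = r := hc
  have hmk : Ideal.Quotient.mk Q (rename e c) = r := by
    rw [← hc]
    have : (Ideal.Quotient.mkₐ F Q).comp (rename e) =
        aeval (fun j => Ideal.Quotient.mk Q (X (e j))) := by
      ext j
      simp
    exact DFunLike.congr_fun this c
  obtain ⟨g, hg⟩ := hdvd
  obtain ⟨g, rfl⟩ := Ideal.Quotient.mk_surjective g
  have hg : r = Ideal.Quotient.mk Q f * Ideal.Quotient.mk Q g := hg
  rw [← hmk, ← map_mul, Ideal.Quotient.eq] at hg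
  have h1 : aeval a (rename e c) = 0 := by
    have h2 := hQa hg
    rw [RingHom.mem_ker, map_sub, map_mul, (show aeval a f = 0 from hf), zero_mul, sub_zero] at h2
    exact h2
  rw [aeval_rename] at h1
  have hc0 : c = 0 := (algebraicIndependent_iff.1 ha) c h1
  apply hr
  ext
  change r = 0
  rw [← hc, hc0, map_zero]

/-- Independent co-ordinates stay independent over `F` at a generic point of the extension of the
variety to `F`. -/
lemma algebraicIndependent_of_ker_eq {ι : Type*} (e : ι → σ)
    (he : AlgebraicIndependent k fun j => Ideal.Quotient.mk I (X (e j))) {a : σ → K}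
    (ha : RingHom.ker (aeval a : MvPolynomial σ F →ₐ[F] K) =
      (I.map (map (algebraMap k F))).radical) :
    AlgebraicIndependent F (a ∘ e) := by
  rw [algebraicIndependent_iff]
  intro p hp
  rw [← aeval_rename] at hp
  have hp' : rename e p ∈ (I.map (map (algebraMap k F))).radical := ha ▸ hp
  obtain ⟨m, hm⟩ := hp'
  rw [← map_pow, mem_map_iff_coeffMap_mem] at hm
  suffices h : p ^ m = 0 from eq_zero_of_pow_eq_zero h
  -- Each functional turns the relation into one over `k` modulo `I`, which is trivial. Functionals
  -- detect zero, as the criterion for the zero ideal says.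
  have h0 : p ^ m ∈ (⊥ : Ideal (MvPolynomial ι k)).map (map (algebraMap k F)) := by
    rw [mem_map_iff_coeffMap_mem]
    intro l
    have h1 := hm l
    rw [coeffMap_rename, ← Ideal.Quotient.eq_zero_iff_mem] at h1
    refine (algebraicIndependent_iff.1 he) _ ?_
    rw [← h1]
    have : (Ideal.Quotient.mkₐ k I).comp (rename e) =
        aeval (fun j => Ideal.Quotient.mk I (X (e j))) := by
      ext j
      simp
    exact (DFunLike.congr_fun this _).symm
  rwa [Ideal.map_bot, Ideal.mem_bot] at h0

variable {I}

/-- The transcendence degree of a point with ideal `I` over an extension of the base field. -/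
lemma trdeg_adjoin_eq_iff_of_ker_eq {ι : Type u} [Finite ι] (e : ι → σ)
    (he : IsTranscendenceBasis k fun j => Ideal.Quotient.mk I (X (e j))) {a : σ → K}
    (ha : RingHom.ker (aeval a : MvPolynomial σ k →ₐ[k] K) = I) :
    Algebra.trdeg F (IntermediateField.adjoin F (Set.range a)) = #ι ↔
      AlgebraicIndependent F (a ∘ e) := by
  have : I.IsPrime := ha ▸ RingHom.ker_isPrime _
  let ψ : (MvPolynomial σ k ⧸ I) →ₐ[k] K := Ideal.Quotient.liftₐ I (aeval a) (fun g hg => by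
    rw [← ha] at hg
    exact hg)
  have hψ : Function.Injective ψ := by
    rw [injective_iff_map_eq_zero]
    intro z
    obtain ⟨g, rfl⟩ := Ideal.Quotient.mk_surjective z
    intro h
    refine Ideal.Quotient.eq_zero_iff_mem.2 ?_
    rw [← ha]
    exact h
  have hψX : ∀ i, ψ (Ideal.Quotient.mk I (X i)) = a i := fun i => aeval_X a i
  have := he.isAlgebraic
  have h := trdeg_adjoin_eq_iff (F := F) ψ hψ (fun i => Ideal.Quotient.mk I (X i))
    (adjoin_mk_X I) (fun j => Ideal.Quotient.mk I (X (e j)))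
  have h1 : (ψ ∘ fun i => Ideal.Quotient.mk I (X i)) = a := _root_.funext hψX
  have h2 : (ψ ∘ fun j => Ideal.Quotient.mk I (X (e j))) = a ∘ e := _root_.funext fun j => hψX (e j)
  rwa [h1, h2] at h

/-- The same over an algebraic extension of the base field. -/
lemma trdeg_adjoin_eq_of_isAlgebraic [Algebra.IsAlgebraic k F] {ι : Type u} [Finite ι] (e : ι → σ)
    (he : IsTranscendenceBasis k fun j => Ideal.Quotient.mk I (X (e j))) {a : σ → K}
    (ha : RingHom.ker (aeval a : MvPolynomial σ k →ₐ[k] K) = I) :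
    Algebra.trdeg F (IntermediateField.adjoin F (Set.range a)) = #ι := by
  rw [trdeg_adjoin_eq_iff_of_ker_eq e he ha]
  refine AlgebraicIndependent.extendScalars (R := k) F ?_
  rw [algebraicIndependent_iff]
  intro p hp
  rw [← aeval_rename] at hp
  have hp' : rename e p ∈ I := ha ▸ hp
  refine (algebraicIndependent_iff.1 he.1) _ ?_
  have : (Ideal.Quotient.mkₐ k I).comp (rename e) =
      aeval (fun j => Ideal.Quotient.mk I (X (e j))) := by
    ext j
    simp
  rw [← this]
  exact Ideal.Quotient.eq_zero_iff_mem.2 hp'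

end Coordinates

end DVar

namespace DVar

open FirstOrder FirstOrder.Language
open scoped TensorProduct

/-! ### Algebraic closedness -/

section AlgebraicallyClosed

/-- Differentially closed fields are algebraically closed. -/
lemma IsDifferentiallyClosed.isAlgClosed {K : Type u} [Field K] [Differential K]
    (hK : IsDifferentiallyClosed K) : IsAlgClosed K := by
  have := hK.1
  refine IsAlgClosed.of_exists_root K fun p hp hirr => ?_
  have : Fact (Irreducible p) := ⟨hirr⟩
  have : Fact p.Monic := ⟨hp⟩
  obtain ⟨t, ht⟩ := exists_term (Polynomial.aeval (MvPolynomial.X 0 : MvPolynomial (Fin 1) K) p)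
  -- The derivation extends to the field obtained by adjoining a root of `p`; the system is the
  -- single equation p(x) = 0.
  obtain ⟨x, hx, -⟩ := hK.2 1 {(t, termZero)} ∅ ⟨AdjoinRoot p, inferInstance, inferInstance,
    inferInstance, inferInstance, inferInstance, fun _ => AdjoinRoot.root p, by
      simp only [Finset.mem_singleton]
      rintro _ rfl
      have := ht (MvPolynomial.aeval (fun _ => AdjoinRoot.root p) :
        MvPolynomial (Fin 1) K →ₐ[K] AdjoinRoot p).toRingHom
      simp only [AlgHom.toRingHom_eq_coe, RingHom.coe_coe, ← Polynomial.aeval_algHom_apply,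
        MvPolynomial.algHom_C, MvPolynomial.aeval_X] at this
      refine this.trans ?_
      rw [AdjoinRoot.aeval_eq, AdjoinRoot.mk_self]
      rfl, by simp⟩
  refine ⟨x 0, ?_⟩
  have h1 := hx _ (Finset.mem_singleton_self _)
  have h2 := ht (MvPolynomial.aeval x : MvPolynomial (Fin 1) K →ₐ[K] K).toRingHom
  simp only [AlgHom.toRingHom_eq_coe, RingHom.coe_coe, ← Polynomial.aeval_algHom_apply,
    MvPolynomial.algHom_C, MvPolynomial.aeval_X] at h2
  have h3 := h2.symm.trans h1
  rwa [Polynomial.coe_aeval_eq_eval] at h3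

end AlgebraicallyClosed

/-! ### Nilpotents in the tensor square of a field extension -/

section TensorSquare

variable {F K : Type*} [Field F] [Field K] [Algebra F K]

/-- Independent powers of `b` over F give powers of 1 ⊗ b independent over the left factor. The base
change of the functional dual to b^j reads off the j-th coefficient of `q`. -/
lemma eq_zero_of_aeval_one_tmul {b : K} {d : ℕ}
    (hb : LinearIndependent F fun i : Fin d => b ^ (i : ℕ)) {q : Polynomial K}
    (hq : q.natDegree < d) (h : Polynomial.aeval ((1 : K) ⊗ₜ[F] b) q = 0) : q = 0 := by
  obtain ⟨g, hg⟩ := (Fintype.linearCombination F fun i : Fin d => b ^ (i : ℕ)).exists_leftInverse_of_injective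
    (LinearMap.ker_eq_bot.2 (hb.fintypeLinearCombination_injective))
  ext j
  by_cases hj : d ≤ j
  · rw [Polynomial.coeff_eq_zero_of_natDegree_lt (hq.trans_le hj), Polynomial.coeff_zero]
  · rw [not_le] at hj
    let l : K →ₗ[F] F := (LinearMap.proj ⟨j, hj⟩).comp g
    let T : K ⊗[F] K →ₗ[K] K :=
      (TensorProduct.AlgebraTensorModule.rid F K K).toLinearMap.comp (l.baseChange K)
    have hT : ∀ i : Fin d, T (((1 : K) ⊗ₜ[F] b) ^ (i : ℕ)) = if (i : ℕ) = j then 1 else 0 := by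
      intro i
      have h1 : g (b ^ (i : ℕ)) = Pi.single i 1 := by
        have := LinearMap.congr_fun hg (Pi.single i 1)
        simpa [Fintype.linearCombination_apply_single] using this
      have h2 : T (((1 : K) ⊗ₜ[F] b) ^ (i : ℕ)) = l (b ^ (i : ℕ)) • (1 : K) := by
        rw [Algebra.TensorProduct.tmul_pow, one_pow]
        rfl
      rw [h2]
      change g (b ^ (i : ℕ)) ⟨j, hj⟩ • (1 : K) = _
      rw [h1, Pi.single_apply]
      by_cases hij : (i : ℕ) = j
      · rw [if_pos hij, if_pos (Fin.ext hij.symm), one_smul]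
      · rw [if_neg hij, if_neg (fun h => hij (congrArg Fin.val h).symm), zero_smul]
    have h3 := congrArg T h
    rw [Polynomial.aeval_eq_sum_range' hq, ← Fin.sum_univ_eq_sum_range
      (fun i => q.coeff i • ((1 : K) ⊗ₜ[F] b) ^ i), map_sum, map_zero] at h3
    simp only [map_smul, hT] at h3
    rw [Finset.sum_eq_single ⟨j, hj⟩] at h3
    · simpa using h3
    · intro i _ hij
      rw [if_neg (fun h => hij (Fin.ext h)), smul_zero]
    · simp

/-- In characteristic zero, `b ⊗ 1 - 1 ⊗ b` is not nilpotent unless it is zero. -/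
lemma not_isNilpotent_tmul_sub [CharZero F] {b : K} (hb : b ∉ (algebraMap F K).range) :
    ¬ IsNilpotent (b ⊗ₜ[F] (1 : K) - (1 : K) ⊗ₜ[F] b) := by
  rintro ⟨n, hn⟩
  let p : Polynomial K := (Polynomial.C b - Polynomial.X) ^ n
  have hp0 : p ≠ 0 := by
    refine pow_ne_zero _ ?_
    rw [← neg_sub, neg_ne_zero]
    exact Polynomial.X_sub_C_ne_zero b
  have hp : Polynomial.aeval ((1 : K) ⊗ₜ[F] b) p = 0 := by
    rw [← hn]
    simp [p, Algebra.TensorProduct.algebraMap_apply]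
  by_cases halg : IsIntegral F b
  · let m := (minpoly F b).map (algebraMap F K)
    have hm : m.Monic := (minpoly.monic halg).map _
    have hmz : Polynomial.aeval ((1 : K) ⊗ₜ[F] b) m = 0 := by
      rw [Polynomial.aeval_map_algebraMap]
      have h1 := Polynomial.aeval_algHom_apply
        (Algebra.TensorProduct.includeRight : K →ₐ[F] K ⊗[F] K) b (minpoly F b)
      rw [minpoly.aeval, map_zero] at h1
      exact h1
    have hmod : Polynomial.aeval ((1 : K) ⊗ₜ[F] b) (p %ₘ m) = 0 := by
      rw [Polynomial.modByMonic_eq_sub_mul_div, map_sub, map_mul, hmz, zero_mul, hp, sub_zero]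
    have hdeg : (p %ₘ m).natDegree < (minpoly F b).natDegree := by
      have := Polynomial.natDegree_modByMonic_lt p hm (by
        intro h1
        have h2 := minpoly.natDegree_pos halg
        have h3 : m.natDegree = (minpoly F b).natDegree := Polynomial.natDegree_map _
        rw [h1, Polynomial.natDegree_one] at h3
        omega)
      rwa [show m.natDegree = (minpoly F b).natDegree from Polynomial.natDegree_map _] at this
    have h0 := eq_zero_of_aeval_one_tmul (linearIndependent_pow b) hdeg hmod
    have hdvd : m ∣ p := (Polynomial.modByMonic_eq_zero_iff_dvd hm).1 h0
    have hsep : m.Separable := (minpoly.irreducible halg).separable.map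
    have hdvd' : m ∣ Polynomial.C b - Polynomial.X := by
      by_cases hn0 : n = 0
      · refine (isUnit_of_dvd_one ?_).dvd
        simpa [p, hn0] using hdvd
      · exact (hsep.squarefree.dvd_pow_iff_dvd hn0).1 hdvd
    have hle : m.natDegree ≤ 1 := by
      have h1 : (Polynomial.C b - Polynomial.X : Polynomial K) ≠ 0 := by
        rw [← neg_sub, neg_ne_zero]
        exact Polynomial.X_sub_C_ne_zero b
      refine (Polynomial.natDegree_le_of_dvd hdvd' h1).trans ?_
      rw [← neg_sub, Polynomial.natDegree_neg, Polynomial.natDegree_X_sub_C]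
    have hnat : (minpoly F b).natDegree ≤ 1 := by
      rwa [show m.natDegree = (minpoly F b).natDegree from Polynomial.natDegree_map _] at hle
    exact hb (minpoly.natDegree_eq_one_iff.1 (le_antisymm hnat (minpoly.natDegree_pos halg)))
  · refine hp0 (eq_zero_of_aeval_one_tmul (d := p.natDegree + 1) ?_ (Nat.lt_succ_self _) hp)
    have htr : Transcendental F b := fun h => halg h.isIntegral
    have hli := (Polynomial.basisMonomials F).linearIndependent.map'
      (Polynomial.aeval b).toLinearMap
      (LinearMap.ker_eq_bot.2 (transcendental_iff_injective.1 htr))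
    have := hli.comp (fun i : Fin (p.natDegree + 1) => (i : ℕ)) Fin.val_injective
    have heq : (((Polynomial.aeval b).toLinearMap ∘ Polynomial.basisMonomials F) ∘
        fun i : Fin (p.natDegree + 1) => (i : ℕ)) =
        fun i : Fin (p.natDegree + 1) => b ^ (i : ℕ) := by
      ext i
      simp [Polynomial.aeval_monomial]
    rwa [heq] at this

end TensorSquare

end DVar

namespace DVar

open FirstOrder FirstOrder.Language

/-! ### Definable closure as generated differential field -/

section DifferentialSubfields

variable {K : Type u} [Field K] [Differential K]

/-- The differential subfield generated by a set, as the set of quotients of values of terms. -/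
def diffField (A : Set K) : Subfield K where
  carrier := {x | ∃ t s : diffRing.Term A, s.realize (↑) ≠ (0 : K) ∧
    x = t.realize (↑) / s.realize (↑)}
  zero_mem' := ⟨termZero, termOne, by simp, by simp⟩
  one_mem' := ⟨termOne, termOne, by simp, by simp⟩
  add_mem' := by
    rintro _ _ ⟨t, s, hs, rfl⟩ ⟨t', s', hs', rfl⟩
    refine ⟨termAdd (termMul t s') (termMul s t'), termMul s s', mul_ne_zero hs hs', ?_⟩
    simp [div_add_div _ _ hs hs']
  mul_mem' := by
    rintro _ _ ⟨t, s, hs, rfl⟩ ⟨t', s', hs', rfl⟩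
    refine ⟨termMul t t', termMul s s', mul_ne_zero hs hs', ?_⟩
    simp [div_mul_div_comm]
  neg_mem' := by
    rintro _ ⟨t, s, hs, rfl⟩
    exact ⟨termSub termZero t, s, hs, by simp [neg_div]⟩
  inv_mem' := by
    rintro _ ⟨t, s, hs, rfl⟩
    by_cases ht : t.realize (↑) = (0 : K)
    · exact ⟨termZero, termOne, by simp, by simp [ht]⟩
    · exact ⟨s, t, ht, inv_div _ _⟩

variable {A : Set K}

lemma subset_diffField : A ⊆ diffField A := fun x hx =>
  ⟨Term.var ⟨x, hx⟩, termOne, by simp, by simp⟩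

lemma deriv_mem_diffField {x : K} (hx : x ∈ diffField A) : Differential.deriv x ∈ diffField A := by
  obtain ⟨t, s, hs, rfl⟩ := hx
  refine ⟨termSub (termMul s (termDeriv t)) (termMul t (termDeriv s)), termMul s s,
    mul_ne_zero hs hs, ?_⟩
  rw [Derivation.leibniz_div]
  simp only [realize_termSub, realize_termMul, realize_termDeriv, smul_eq_mul]
  field_simp

instance : Differential (diffField A) where
  deriv := Derivation.mk' (AddMonoidHom.toIntLinearMap
    { toFun := fun x => ⟨Differential.deriv (x : K), deriv_mem_diffField x.2⟩
      map_zero' := Subtype.ext (map_zero _)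
      map_add' := fun x y => Subtype.ext (map_add _ (x : K) (y : K)) })
    (fun x y => Subtype.ext (Derivation.leibniz _ (x : K) (y : K)))

instance : DifferentialAlgebra (diffField A) K where
  deriv_algebraMap _ := rfl

lemma diffField_le {F : Subfield K} (hA : A ⊆ F) (hF : ∀ x ∈ F, Differential.deriv x ∈ F) :
    diffField A ≤ F := by
  have key : ∀ t : diffRing.Term A, t.realize (↑) ∈ F := by
    intro t
    induction t with
    | var x => exact hA x.2
    | func f ts ih =>
      cases f with
      | zero => exact F.zero_mem
      | one => exact F.one_mem
      | add => exact F.add_mem (ih 0) (ih 1)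
      | sub => exact F.sub_mem (ih 0) (ih 1)
      | mul => exact F.mul_mem (ih 0) (ih 1)
      | deriv => exact hF _ (ih 0)
  rintro _ ⟨t, s, -, rfl⟩
  exact F.div_mem (key t) (key s)

lemma card_diffField_lt {κ : Cardinal.{u}} (hℵ : ℵ₀ < κ) (hA : #A < κ) : #(diffField A) < κ := by
  have h1 : #(Σ i, diffRing.Functions i) ≤ ℵ₀ := by
    let f : (Σ i, diffRing.Functions i) → ℕ := fun p =>
      match p with
      | ⟨_, DiffRingFunc.zero⟩ => 0
      | ⟨_, DiffRingFunc.one⟩ => 1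
      | ⟨_, DiffRingFunc.add⟩ => 2
      | ⟨_, DiffRingFunc.sub⟩ => 3
      | ⟨_, DiffRingFunc.mul⟩ => 4
      | ⟨_, DiffRingFunc.deriv⟩ => 5
    have hf : Function.Injective f := by
      rintro ⟨_, _ | _⟩ ⟨_, _ | _⟩ h <;> first | rfl | exact absurd h (by simp [f])
    exact Cardinal.mk_le_aleph0_iff.2 hf.countable
  have h2 : #(diffRing.Term A) < κ := by
    refine Term.card_le.trans_lt (max_lt hℵ ?_)
    rw [Cardinal.mk_sum]
    refine Cardinal.add_lt_of_lt hℵ.le (by simpa using hA) ?_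
    exact (Cardinal.lift_le_aleph0.2 h1).trans_lt hℵ
  have h3 : Function.Surjective fun p : {p : diffRing.Term A × diffRing.Term A //
      p.2.realize (↑) ≠ (0 : K)} =>
      (⟨p.1.1.realize (↑) / p.1.2.realize (↑), p.1.1, p.1.2, p.2, rfl⟩ : diffField A) := by
    rintro ⟨_, t, s, hs, rfl⟩
    exact ⟨⟨(t, s), hs⟩, rfl⟩
  refine (Cardinal.mk_le_of_surjective h3).trans_lt
    ((Cardinal.mk_subtype_le _).trans_lt ?_)
  rw [Cardinal.mk_prod, Cardinal.lift_id]
  exact Cardinal.mul_lt_of_lt hℵ.le h2 h2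

lemma diffField_subset_dcl : (diffField A : Set K) ⊆ dcl A := by
  rintro _ ⟨t, s, hs, rfl⟩
  refine Set.definable_iff_exists_formula_sum.2
    ⟨(termMul (s.relabel Sum.inl) (Term.var (Sum.inr 0))).equal (t.relabel Sum.inl), ?_⟩
  ext x
  simp only [Set.mem_ofPred_eq, Formula.realize_equal, realize_termMul, Term.realize_relabel,
    Sum.elim_comp_inl, Term.realize_var, Sum.elim_inr]
  change x 0 = _ ↔ _
  rw [eq_div_iff hs, mul_comm]

/-- For `b` outside F = `diffField A`, the element b ⊗ 1 − 1 ⊗ b of K ⊗_F K is not nilpotent, so two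
copies of `K` amalgamate over F with the images of `b` distinct. Copying the second image into `K`
over A ∪ {b} gives a second realisation of tp(b/A), so `b` is not definable. -/
lemma dcl_subset_diffField (hK : IsDifferentiallyClosed K) {κ : Cardinal.{u}}
    (hκ : IsSaturated K κ) (hℵ : ℵ₀ < κ) (hA : #A < κ) : dcl A ⊆ diffField A := by
  have := hK.1
  intro b hb
  by_contra hbF
  let F := diffField A
  have hb' : b ∉ (algebraMap F K).range := by
    rintro ⟨x, rfl⟩
    exact hbF x.2
  have hnil := not_isNilpotent_tmul_sub hb'
  open TensorProduct in
  obtain ⟨S, _, _, _, i, j, hi, hj, hij, hne⟩ := exists_amalgam (K := K) (R := K) isUnit_natCast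
    {p : K × K | p.1 ∈ F ∧ p.2 = p.1} (by
      rintro ⟨x, y⟩ ⟨hx, hy⟩
      exact ⟨deriv_mem_diffField hx, congrArg _ hy⟩)
    (Algebra.TensorProduct.includeLeft : K →ₐ[F] K ⊗[F] K).toRingHom
    (Algebra.TensorProduct.includeRight : K →ₐ[F] K ⊗[F] K).toRingHom (by
      rintro ⟨x, y⟩ ⟨hx, hy⟩
      have hy : y = x := hy
      subst hy
      exact ((Algebra.TensorProduct.includeLeft : K →ₐ[F] K ⊗[F] K).commutes ⟨y, hx⟩).trans
        ((Algebra.TensorProduct.includeRight : K →ₐ[F] K ⊗[F] K).commutes ⟨y, hx⟩).symm)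
    (Submonoid.powers (b ⊗ₜ[ℤ] (1 : K) - (1 : K) ⊗ₜ[ℤ] b)) (by
      rintro _ ⟨n, rfl⟩ h
      refine hnil ⟨n, ?_⟩
      simpa using h)
  have hbij : i b ≠ j b := by
    have := hne _ (Submonoid.mem_powers _)
    intro h
    apply this
    simp [h]
  obtain ⟨d, hd⟩ := exists_sameTerms_of_hom hK hκ (card_sum_fin_lt hℵ hA 1)
    (Sum.elim (↑) ![b] : A ⊕ Fin 1 → K) i hi ![j b]
  have hdb : d 0 ≠ b := by
    intro h
    exact hbij ((hd (Term.var (Sum.inl (Sum.inr 0))) (Term.var (Sum.inr 0))).1 h.symm)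
  have h1 : SameTerms (Sum.elim (↑) d : A ⊕ Fin 1 → K) (Sum.elim (↑) ![b] : A ⊕ Fin 1 → K) := by
    have h2 := hd.comp (Sum.elim (Sum.inl ∘ Sum.inl) Sum.inr : A ⊕ Fin 1 → (A ⊕ Fin 1) ⊕ Fin 1)
    have h3 := sameTerms_map j hj j.injective (Sum.elim (↑) ![b] : A ⊕ Fin 1 → K)
    have h4 : ((Sum.elim (i ∘ Sum.elim (↑) ![b]) ![j b] : (A ⊕ Fin 1) ⊕ Fin 1 → S) ∘
        (Sum.elim (Sum.inl ∘ Sum.inl) Sum.inr : A ⊕ Fin 1 → (A ⊕ Fin 1) ⊕ Fin 1)) =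
        j ∘ (Sum.elim (↑) ![b] : A ⊕ Fin 1 → K) := by
      ext z
      rcases z with z | z
      · exact hij ((z : K), (z : K)) ⟨subset_diffField z.2, rfl⟩
      · fin_cases z
        rfl
    have h5 : ((Sum.elim (Sum.elim (↑) ![b]) d : (A ⊕ Fin 1) ⊕ Fin 1 → K) ∘
        (Sum.elim (Sum.inl ∘ Sum.inl) Sum.inr : A ⊕ Fin 1 → (A ⊕ Fin 1) ⊕ Fin 1)) =
        (Sum.elim (↑) d : A ⊕ Fin 1 → K) := by
      ext z
      rcases z with z | z <;> rfl
    rw [h4, h5] at h2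
    exact fun t s => (h2 t s).trans (h3 t s).symm
  obtain ⟨φ, hφ⟩ := Set.definable_iff_exists_formula_sum.1 hb
  have h2 := tp_eq_iff.1 ((tp_eq_iff_sameTerms hK hκ hℵ hA).2 h1) φ
  have h3 := Set.ext_iff.1 hφ ![b]
  have h4 := Set.ext_iff.1 hφ d
  exact hdb (h4.2 (h2.2 (h3.1 rfl)))

lemma closure_dcl (hK : IsDifferentiallyClosed K) {κ : Cardinal.{u}}
    (hκ : IsSaturated K κ) (hℵ : ℵ₀ < κ) (hA : #A < κ) :
    Subfield.closure (dcl A) = diffField A := by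
  rw [(dcl_subset_diffField hK hκ hℵ hA).antisymm diffField_subset_dcl, Subfield.closure_eq]

end DifferentialSubfields

/-! ### Dimension and independence of solutions -/

section Dimension

variable {K : Type u} [Field K] [Differential K] {k : Type u} [Field k] [Differential k]
  [Algebra k K] [DifferentialAlgebra k K] {n : ℕ}

/-- By δa = s(a), every iterated derivative of `a` is a polynomial in `a` over `k`, so derivatives
add nothing to F(a). -/
lemma dimSeq_eq_trdeg {F : Subfield K} [Algebra k F] [IsScalarTower k F K]
    (s : Fin n → MvPolynomial (Fin n) k) {a : Fin n → K}
    (ha : ∀ i, Differential.deriv (a i) = MvPolynomial.aeval a (s i)) (l : ℕ) :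
    dimSeq F a l = Algebra.trdeg F (IntermediateField.adjoin F (Set.range a)) := by
  have hmem : ∀ f : MvPolynomial (Fin n) k,
      MvPolynomial.aeval a f ∈ IntermediateField.adjoin F (Set.range a) := by
    intro f
    rw [← MvPolynomial.aeval_map_algebraMap F]
    refine IntermediateField.algebra_adjoin_le_adjoin F _ ?_
    rw [Algebra.adjoin_range_eq_range_aeval]
    exact ⟨_, rfl⟩
  have hiter : ∀ (i : ℕ) (j : Fin n), ∃ f : MvPolynomial (Fin n) k,
      (fun y : K => Differential.deriv y)^[i] (a j) = MvPolynomial.aeval a f := by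
    intro i j
    induction i with
    | zero => exact ⟨MvPolynomial.X j, by simp⟩
    | succ i ih =>
      obtain ⟨f, hf⟩ := ih
      exact ⟨polyDeriv s f, by rw [Function.iterate_succ_apply', hf, deriv_aeval s ha]⟩
  have heq : IntermediateField.adjoin F
      {x : K | ∃ i ≤ l, ∃ j, x = (fun y : K => Differential.deriv y)^[i] (a j)} =
      IntermediateField.adjoin F (Set.range a) := by
    apply le_antisymm
    · rw [IntermediateField.adjoin_le_iff]
      rintro _ ⟨i, -, j, rfl⟩
      obtain ⟨f, hf⟩ := hiter i j
      rw [hf]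
      exact hmem f
    · refine IntermediateField.adjoin.mono F _ _ ?_
      rintro _ ⟨j, rfl⟩
      exact ⟨0, Nat.zero_le _, j, rfl⟩
  rw [dimSeq, heq]

/-- The inclusion of the base field in a differential subfield containing it. -/
@[reducible]
def algebraDiffField {A : Set K} (h : Set.range (algebraMap k K) ⊆ A) : Algebra k (diffField A) :=
  ((algebraMap k K).codRestrict (diffField A) fun x => subset_diffField (h ⟨x, rfl⟩)).toAlgebra

lemma isScalarTower_diffField {A : Set K} (h : Set.range (algebraMap k K) ⊆ A) :
    letI := algebraDiffField h
    IsScalarTower k (diffField A) K :=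
  letI := algebraDiffField h
  IsScalarTower.of_algebraMap_eq fun _ => rfl

lemma differentialAlgebra_diffField {A : Set K} (h : Set.range (algebraMap k K) ⊆ A) :
    letI := algebraDiffField h
    DifferentialAlgebra k (diffField A) :=
  letI := algebraDiffField h
  ⟨fun x => Subtype.ext (DifferentialAlgebra.deriv_algebraMap (A := k) (B := K) x)⟩

/-- Independence over the base field of a generic point. -/
lemma indep_iff (hK : IsDifferentiallyClosed K) {κ : Cardinal.{u}} (hκ : IsSaturated K κ)
    (hℵ : ℵ₀ < κ) (hk : #k < κ) {A : Set K} (hA : #A < κ) [Algebra k (diffField A)]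
    [IsScalarTower k (diffField A) K]
    {I : Ideal (MvPolynomial (Fin n) k)} {ι : Type u} [Finite ι] (e : ι → Fin n)
    (he : IsTranscendenceBasis k fun j => Ideal.Quotient.mk I (MvPolynomial.X (e j)))
    (s : Fin n → MvPolynomial (Fin n) k) {a : Fin n → K}
    (ha : ∀ i, Differential.deriv (a i) = MvPolynomial.aeval a (s i))
    (hI : RingHom.ker (MvPolynomial.aeval a : MvPolynomial (Fin n) k →ₐ[k] K) = I) :
    Indep a (Set.range (algebraMap k K)) A ↔ AlgebraicIndependent (diffField A) (a ∘ e) := by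
  let _ := algebraDiffField (Set.Subset.refl (Set.range (algebraMap k K)))
  have := isScalarTower_diffField (Set.Subset.refl (Set.range (algebraMap k K)))
  -- The image of `k` is already a differential field, so the base of the comparison is `k` itself.
  have hle : diffField (Set.range (algebraMap k K)) ≤ (algebraMap k K).fieldRange := by
    refine diffField_le (fun x hx => hx) ?_
    rintro _ ⟨x, rfl⟩
    exact ⟨Differential.deriv x, (DifferentialAlgebra.deriv_algebraMap x).symm⟩
  have halg : Algebra.IsAlgebraic k (diffField (Set.range (algebraMap k K))) := by
    refine ⟨fun x => ?_⟩
    obtain ⟨y, hy⟩ := hle x.2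
    have : x = algebraMap k _ y := Subtype.ext hy.symm
    rw [this]
    exact isAlgebraic_algebraMap y
  have h0 : dimSeq (diffField (Set.range (algebraMap k K))) a = fun _ => #ι := by
    funext l
    rw [dimSeq_eq_trdeg s ha, trdeg_adjoin_eq_of_isAlgebraic e he hI]
  rw [Indep, closure_dcl hK hκ hℵ hA, closure_dcl hK hκ hℵ (Cardinal.mk_range_le.trans_lt hk), h0,
    ← trdeg_adjoin_eq_iff_of_ker_eq (F := diffField A) e he hI]
  constructor
  · intro h
    rw [← dimSeq_eq_trdeg s ha 0, h]
  · intro h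
    funext l
    rw [dimSeq_eq_trdeg s ha, h]

end Dimension

end DVar

namespace DVar

open MvPolynomial

/-! ### Prime differential ideals over an extension of the base -/

section PrimeDifferentialIdeals

variable {k : Type u} [Field k] [Differential k] {F : Type v} [Field F] [Differential F]
  [Algebra k F] [DifferentialAlgebra k F] [CharZero F] {σ : Type w} [Fintype σ]

lemma isUnit_natCast_mvPolynomial (n : ℕ) (hn : n ≠ 0) : IsUnit (n : MvPolynomial σ F) := by
  rw [← map_natCast (C : F →+* MvPolynomial σ F)]
  exact (isUnit_natCast n hn).map C

lemma polyDeriv_mem_radical_map (s : σ → MvPolynomial σ k) {I : Ideal (MvPolynomial σ k)}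
    (hI : ∀ f ∈ I, polyDeriv s f ∈ I) :
    ∀ f ∈ (I.map (map (algebraMap k F))).radical,
      polyDeriv (fun i => map (algebraMap k F) (s i)) f ∈
        (I.map (map (algebraMap k F))).radical := fun _ hf =>
  deriv_mem_radical _ isUnit_natCast_mvPolynomial (polyDeriv_mem_map s hI) hf

/-- A polynomial that does not vanish on the base extension of an irreducible `D`-variety does not
vanish on some irreducible `D`-subvariety that is dense over the base field. -/
lemma exists_prime_differential_comap_eq (s : σ → MvPolynomial σ k)
    {I : Ideal (MvPolynomial σ k)} [I.IsPrime] (hI : ∀ f ∈ I, polyDeriv s f ∈ I)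
    {h : MvPolynomial σ F} (hh : h ∉ (I.map (map (algebraMap k F))).radical) :
    ∃ P : Ideal (MvPolynomial σ F), P.IsPrime ∧ I.map (map (algebraMap k F)) ≤ P ∧
      (∀ f ∈ P, polyDeriv (fun i => map (algebraMap k F) (s i)) f ∈ P) ∧
      P.comap (map (algebraMap k F)) = I ∧ h ∉ P := by
  obtain ⟨P, hP, hIP, hδ, hS⟩ := exists_prime_differential_ideal _ isUnit_natCast_mvPolynomial
    (polyDeriv_mem_map (E := F) s hI)
    -- Avoiding the complement of `I` forces the contraction to be `I`; avoiding the powers of `h`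
    -- keeps `h` out. Elements of that complement are regular modulo the extended ideal, so the
    -- product set misses it.
    (I.primeCompl.map (map (algebraMap k F)) ⊔ Submonoid.powers h) (by
      intro x hx hxI
      obtain ⟨_, ⟨p, hp, rfl⟩, _, ⟨m, rfl⟩, rfl⟩ := Submonoid.mem_sup.1 hx
      exact hh ⟨m, mem_map_of_map_mul_mem hp hxI⟩)
  refine ⟨P, hP, hIP, hδ, le_antisymm (fun p hp => ?_) (Ideal.map_le_iff_le_comap.1 hIP),
    hS _ (Submonoid.mem_sup_right (Submonoid.mem_powers h))⟩
  by_contra hpI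
  exact hS _ (Submonoid.mem_sup_left ⟨p, hpI, rfl⟩) hp

end PrimeDifferentialIdeals

/-! ### The generic type and its stationarity -/

section GenericTypes

variable {K : Type u} [Field K] [Differential K] {k : Type u} [Field k] [Differential k]
  [Algebra k K] [DifferentialAlgebra k K] {n : ℕ}

lemma comap_ker_aeval {F : Type*} [Field F] [Algebra F K] [Algebra k F] [IsScalarTower k F K]
    (a : Fin n → K) :
    (RingHom.ker (aeval a : MvPolynomial (Fin n) F →ₐ[F] K)).comap (map (algebraMap k F)) =
      RingHom.ker (aeval a : MvPolynomial (Fin n) k →ₐ[k] K) := by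
  ext f
  simp only [Ideal.mem_comap, RingHom.mem_ker, aeval_map_algebraMap]

namespace DVariety

variable (X : DVariety k (Fin n))

lemma tp_eq_iff_isGenericDPoint (hK : IsDifferentiallyClosed K) {κ : Cardinal.{u}}
    (hκ : IsSaturated K κ) (hℵ : ℵ₀ < κ) (hk : #k < κ) {a b : Fin n → K}
    (ha : X.IsGenericDPoint a) :
    tp (Set.range (algebraMap k K)) b = tp (Set.range (algebraMap k K)) a ↔
      X.IsGenericDPoint b := by
  obtain ⟨ha1, ha2⟩ := (X.isGenericDPoint_iff a).1 ha
  rw [eq_comm, tp_range_eq_iff_sameTerms hK hκ hℵ hk, sameTerms_iff_ker_eq X.sectionPoly ha1,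
    X.isGenericDPoint_iff, ha2, eq_comm (a := X.V.ideal)]

lemma exists_isGenericDPoint_of_isPrime (hK : IsDifferentiallyClosed K) {κ : Cardinal.{u}}
    (hκ : IsSaturated K κ) {F : Type u} [Field F] [Differential F] [Algebra F K]
    [DifferentialAlgebra F K] [Algebra k F] [IsScalarTower k F K] (hF : #F < κ)
    (P : Ideal (MvPolynomial (Fin n) F)) [P.IsPrime]
    (hP : ∀ f ∈ P, polyDeriv (fun i => map (algebraMap k F) (X.sectionPoly i)) f ∈ P)
    (hPI : P.comap (map (algebraMap k F)) = X.V.ideal) :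
    ∃ a : Fin n → K, X.IsGenericDPoint a ∧
      RingHom.ker (aeval a : MvPolynomial (Fin n) F →ₐ[F] K) = P := by
  obtain ⟨a, ha, hker⟩ := exists_point hK hκ hF _ P hP
  refine ⟨a, (X.isGenericDPoint_iff a).2 ⟨fun i => ?_, ?_⟩, hker⟩
  · rw [ha, aeval_map_algebraMap]
  · rw [← comap_ker_aeval (F := F), hker, hPI]

lemma exists_isGenericDPoint (hK : IsDifferentiallyClosed K) {κ : Cardinal.{u}}
    (hκ : IsSaturated K κ) (hk : #k < κ) (hX : X.V.IsIrreducible) :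
    ∃ a : Fin n → K, X.IsGenericDPoint a := by
  have : X.V.ideal.IsPrime := hX
  obtain ⟨a, ha⟩ := exists_point hK hκ hk X.sectionPoly X.V.ideal fun _ => X.polyDeriv_mem
  exact ⟨a, (X.isGenericDPoint_iff a).2 ha⟩

theorem existsUnique_isGenericType (hK : IsDifferentiallyClosed K) {κ : Cardinal.{u}}
    (hκ : IsSaturated K κ) (hℵ : ℵ₀ < κ) (hk : #k < κ) (hX : X.V.IsIrreducible) :
    ∃! p : TypeSpace (Set.range (algebraMap k K)) n, IsGenericType X p := by
  obtain ⟨a, ha⟩ := X.exists_isGenericDPoint hK hκ hk hX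
  refine ⟨tp _ a, fun b => X.tp_eq_iff_isGenericDPoint hK hκ hℵ hk ha, fun p hp => ?_⟩
  obtain ⟨b, rfl⟩ := hκ _ (Cardinal.mk_range_le.trans_lt hk) n p
  exact (X.tp_eq_iff_isGenericDPoint hK hκ hℵ hk ha).2 ((hp b).1 rfl)

variable {X}

lemma IsGenericDPoint.deriv_eq_map {F : Type*} [Field F] [Algebra F K] [Algebra k F]
    [IsScalarTower k F K] {a : Fin n → K} (ha : X.IsGenericDPoint a) (i : Fin n) :
    Differential.deriv (a i) = aeval a (map (algebraMap k F) (X.sectionPoly i)) := by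
  rw [aeval_map_algebraMap, ((X.isGenericDPoint_iff a).1 ha).1]

lemma tp_eq_of_ker_eq (hK : IsDifferentiallyClosed K) {κ : Cardinal.{u}}
    (hκ : IsSaturated K κ) (hℵ : ℵ₀ < κ) {A : Set K} (hA : #A < κ) [Algebra k (diffField A)]
    [IsScalarTower k (diffField A) K] {a b : Fin n → K} (ha : X.IsGenericDPoint a)
    (hb : X.IsGenericDPoint b)
    (h : RingHom.ker (aeval a : MvPolynomial (Fin n) (diffField A) →ₐ[diffField A] K) =
      RingHom.ker (aeval b : MvPolynomial (Fin n) (diffField A) →ₐ[diffField A] K)) :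
    tp A a = tp A b := by
  rw [tp_eq_iff_sameTerms hK hκ hℵ hA]
  have := ((sameTerms_iff_ker_eq _ ha.deriv_eq_map).2 ⟨hb.deriv_eq_map, h⟩).comp
    (Sum.map (fun x : A => (⟨x, subset_diffField x.2⟩ : diffField A)) id)
  rwa [Sum.elim_comp_map, Sum.elim_comp_map] at this

/-- The condition `hAF` makes `A` itself a differential field, so that coefficients of polynomials
are parameters of the type. -/
lemma ker_eq_of_tp_eq (hK : IsDifferentiallyClosed K) {κ : Cardinal.{u}}
    (hκ : IsSaturated K κ) (hℵ : ℵ₀ < κ) {A : Set K} (hA : #A < κ) [Algebra k (diffField A)]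
    [IsScalarTower k (diffField A) K] (hAF : (diffField A : Set K) ⊆ A) {a b : Fin n → K}
    (ha : X.IsGenericDPoint a) (h : tp A a = tp A b) :
    RingHom.ker (aeval a : MvPolynomial (Fin n) (diffField A) →ₐ[diffField A] K) =
      RingHom.ker (aeval b : MvPolynomial (Fin n) (diffField A) →ₐ[diffField A] K) := by
  rw [tp_eq_iff_sameTerms hK hκ hℵ hA] at h
  have := h.comp (Sum.map (fun x : diffField A => (⟨x, hAF x.2⟩ : A)) id)
  rw [Sum.elim_comp_map, Sum.elim_comp_map] at this
  exact ((sameTerms_iff_ker_eq (F := diffField A) _ ha.deriv_eq_map).1 this).2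

/-- Over the differential field generated by `A`, the ideal of V stays prime up to radical and stays
differential, hence has a generic solution, and this is independent. Any independent realisation has
the same ideal by `ker_aeval_eq_of_algebraicIndependent`, and the ideal determines the type. -/
theorem isStationary_of_isAbsolutelyIrreducible (hK : IsDifferentiallyClosed K)
    {κ : Cardinal.{u}} (hκ : IsSaturated K κ) (hℵ : ℵ₀ < κ) (hk : #k < κ)
    (hX : X.V.IsIrreducible) (hV : X.V.IsAbsolutelyIrreducible)
    {p : TypeSpace (Set.range (algebraMap k K)) n} (hp : IsGenericType X p) :
    IsStationary κ p := by
  intro A hBA hA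
  have := hK.1
  have : X.V.ideal.IsPrime := hX
  let _ := algebraDiffField hBA
  have := isScalarTower_diffField hBA
  have := differentialAlgebra_diffField hBA
  have : ((X.V.ideal).map (map (algebraMap k (diffField A)))).radical.IsPrime := hV (diffField A)
  have : CharZero (diffField A) := (algebraMap (diffField A) K).charZero
  have hcomap := comap_radical_map (F := diffField A) X.V.isRadical
  obtain ⟨ι, _, e, he⟩ := exists_isTranscendenceBasis_coord X.V.ideal
  obtain ⟨a, ha, hker⟩ := X.exists_isGenericDPoint_of_isPrime hK hκ (card_diffField_lt hℵ hA) _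
    (polyDeriv_mem_radical_map X.sectionPoly fun _ => X.polyDeriv_mem) hcomap
  have hindep : ∀ {b : Fin n → K}, X.IsGenericDPoint b →
      (Indep b (Set.range (algebraMap k K)) A ↔ AlgebraicIndependent (diffField A) (b ∘ e)) := by
    intro b hb
    obtain ⟨h1, h2⟩ := (X.isGenericDPoint_iff b).1 hb
    exact indep_iff hK hκ hℵ hk hA e he X.sectionPoly h1 h2
  refine ⟨tp A a, ⟨a, rfl, (hp a).2 ha,
    (hindep ha).2 (algebraicIndependent_of_ker_eq _ e he.1 hker)⟩, ?_⟩
  rintro _ ⟨b, rfl, hbp, hb⟩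
  have hb' := (hp b).1 hbp
  refine tp_eq_of_ker_eq hK hκ hℵ hA hb' ha ?_
  rw [hker]
  refine ker_aeval_eq_of_algebraicIndependent _ hcomap e he ?_ ((hindep hb').1 hb)
  refine (RingHom.ker_isPrime _).isRadical.radical_le_iff.2 (Ideal.map_le_iff_le_comap.2 ?_)
  rw [comap_ker_aeval, ((X.isGenericDPoint_iff b).1 hb').2]

end DVariety

/-- Differentiate the minimal polynomial at `x` and solve for δx; separability makes the denominator
nonzero. -/
lemma deriv_mem_algebraicClosure [CharZero K] {x : K} (hx : x ∈ algebraicClosure k K) :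
    Differential.deriv x ∈ algebraicClosure k K := by
  have : CharZero k := (algebraMap k K).charZero_iff (algebraMap k K).injective |>.2 ‹_›
  have hint : IsIntegral k x := (mem_algebraicClosure_iff.1 hx).isIntegral
  have hne : Polynomial.aeval x (Polynomial.derivative (minpoly k x)) ≠ 0 :=
    (minpoly.irreducible hint).separable.aeval_derivative_ne_zero (minpoly.aeval k x)
  have h := Differential.deriv_aeval_eq x (minpoly k x)
  rw [minpoly.aeval, map_zero] at h
  have hmem : ∀ p : Polynomial k, Polynomial.aeval x p ∈ algebraicClosure k K := fun p =>
    IntermediateField.algebra_adjoin_le_adjoin k _ |>.trans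
      (IntermediateField.adjoin_le_iff.2 (Set.singleton_subset_iff.2 hx))
      (Polynomial.aeval_mem_adjoin_singleton k x)
  have : Differential.deriv x = -Polynomial.aeval x (Differential.mapCoeffs (minpoly k x)) /
      Polynomial.aeval x (Polynomial.derivative (minpoly k x)) := by
    rw [eq_div_iff hne, mul_comm, eq_neg_iff_add_eq_zero, add_comm, ← h]
  rw [this]
  exact div_mem (neg_mem (hmem _)) (hmem _)

lemma diffField_algebraicClosure [CharZero K] :
    diffField (algebraicClosure k K : Set K) = (algebraicClosure k K).toSubfield :=
  le_antisymm (diffField_le (fun _ hx => hx) fun _ hx => deriv_mem_algebraicClosure hx)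
    subset_diffField

namespace DVariety

variable {X : DVariety k (Fin n)}

theorem isAbsolutelyIrreducible_of_isStationary (hK : IsDifferentiallyClosed K)
    {κ : Cardinal.{u}} (hκ : IsSaturated K κ) (hℵ : ℵ₀ < κ) (hk : #k < κ)
    (hX : X.V.IsIrreducible) {p : TypeSpace (Set.range (algebraMap k K)) n}
    (hp : IsGenericType X p) (hst : IsStationary κ p) : X.V.IsAbsolutelyIrreducible := by
  have := hK.1
  have := hK.isAlgClosed
  have : X.V.ideal.IsPrime := hX
  obtain ⟨A, hAdef⟩ : ∃ A : Set K, A = algebraicClosure k K := ⟨_, rfl⟩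
  have hBA : Set.range (algebraMap k K) ⊆ A := by
    rintro _ ⟨x, rfl⟩
    rw [hAdef]
    exact (algebraicClosure k K).algebraMap_mem x
  have hA : #A < κ := by
    rw [hAdef]
    exact (Algebra.IsAlgebraic.cardinalMk_le_max k (algebraicClosure k K)).trans_lt
      (max_lt hk hℵ)
  have hF : diffField A = (algebraicClosure k K).toSubfield := by
    rw [hAdef, diffField_algebraicClosure]
  have hAF : (diffField A : Set K) ⊆ A := by rw [hF, hAdef]; exact subset_rfl
  let _ := algebraDiffField hBA
  have := isScalarTower_diffField hBA
  have := differentialAlgebra_diffField hBA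
  have : CharZero (diffField A) := (algebraMap (diffField A) K).charZero
  have : Algebra.IsAlgebraic k (diffField A) := by
    refine ⟨fun x => ?_⟩
    have hx : (x : K) ∈ algebraicClosure k K := hF.le x.2
    exact (isAlgebraic_algebraMap_iff (algebraMap (diffField A) K).injective).1
      (mem_algebraicClosure_iff.1 hx)
  have : IsAlgClosed (diffField A) := by
    rw [hF]
    exact (algebraicClosure.isAlgClosure k K).isAlgClosed
  obtain ⟨ι, _, e, he⟩ := exists_isTranscendenceBasis_coord X.V.ideal
  -- Passing to the algebraic closure does not change transcendence degree, so every generic D-point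
  -- is independent from `A`; only the choice of the prime, omitting `h`, matters.
  have key : ∀ h : MvPolynomial (Fin n) (diffField A),
      h ∉ (X.V.ideal.map (map (algebraMap k (diffField A)))).radical →
      ∃ a : Fin n → K, X.IsGenericDPoint a ∧ aeval a h ≠ 0 ∧
        IsNonforkingExtension p (tp A a) := by
    intro h hh
    obtain ⟨P, hP, -, hδ, hcomap, hhP⟩ := exists_prime_differential_comap_eq X.sectionPoly
      (fun _ => X.polyDeriv_mem) hh
    obtain ⟨a, ha, hker⟩ := X.exists_isGenericDPoint_of_isPrime hK hκ
      (card_diffField_lt hℵ hA) P hδ hcomap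
    obtain ⟨ha1, ha2⟩ := (X.isGenericDPoint_iff a).1 ha
    refine ⟨a, ha, fun h0 => hhP (hker ▸ h0), a, rfl, (hp a).2 ha, ?_⟩
    rw [indep_iff hK hκ hℵ hk hA e he X.sectionPoly ha1 ha2,
      ← trdeg_adjoin_eq_iff_of_ker_eq (F := diffField A) e he ha2]
    exact trdeg_adjoin_eq_of_isAlgebraic e he ha2
  refine AffineVariety.isAbsolutelyIrreducible_of_isAlgClosed X.V (F := diffField A) ?_
  change (X.V.ideal.map (map (algebraMap k (diffField A)))).radical.IsPrime
  constructor
  · intro htop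
    have h := comap_radical_map (F := diffField A) X.V.isRadical
    rw [htop, Ideal.comap_top] at h
    exact hX.ne_top h.symm
  · intro f g hfg
    by_contra! hne
    obtain ⟨a, ha, haf, ha'⟩ := key f hne.1
    obtain ⟨b, hb, hbg, hb'⟩ := key g hne.2
    -- Stationarity identifies the two types over `A`, hence the two ideals. The common ideal is
    -- prime and contains fg but neither factor.
    have hker := ker_eq_of_tp_eq hK hκ hℵ hA hAF ha ((hst A hBA hA).unique ha' hb')
    have h0 : aeval a (f * g) = 0 := by
      have hle : (X.V.ideal.map (map (algebraMap k (diffField A)))).radical ≤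
          RingHom.ker (aeval a : MvPolynomial (Fin n) (diffField A) →ₐ[diffField A] K) := by
        refine (RingHom.ker_isPrime _).isRadical.radical_le_iff.2
          (Ideal.map_le_iff_le_comap.2 ?_)
        rw [comap_ker_aeval, ((X.isGenericDPoint_iff a).1 ha).2]
      exact hle hfg
    rw [map_mul, mul_eq_zero] at h0
    have hg : g ∈ RingHom.ker
        (aeval a : MvPolynomial (Fin n) (diffField A) →ₐ[diffField A] K) :=
      h0.resolve_left haf
    rw [hker] at hg
    exact hbg hg

end DVariety

end GenericTypes

end DVar

theorem proposition4 {𝕂 : Type u} [Field 𝕂] [Differential 𝕂]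
    (h𝕂 : DVar.IsDifferentiallyClosed 𝕂)
    (κ : Cardinal.{u}) (hκ : DVar.IsSaturated 𝕂 κ)
    {k : Type u} [Field k] [Differential k] [Algebra k 𝕂] [DifferentialAlgebra k 𝕂]
    (hk : Cardinal.mk k < κ)
    {n : ℕ} (X : DVar.DVariety k (Fin n)) (hX : X.V.IsIrreducible) :
    (∃! p : DVar.TypeSpace (Set.range (algebraMap k 𝕂)) n, DVar.IsGenericType X p) ∧
    ∀ p : DVar.TypeSpace (Set.range (algebraMap k 𝕂)) n, DVar.IsGenericType X p →
      (X.V.IsAbsolutelyIrreducible ↔ DVar.IsStationary κ p) := by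
  have := h𝕂.1
  have : CharZero k := (algebraMap k 𝕂).charZero_iff (algebraMap k 𝕂).injective |>.2 ‹_›
  -- In characteristic zero `k` is infinite, so its smallness makes κ uncountable. Then differential
  -- fields generated by small sets, and the algebraic closure of `k`, are small.
  have hℵ : ℵ₀ < κ := (Cardinal.infinite_iff.1 (CharZero.infinite k)).trans_lt hk
  exact ⟨X.existsUnique_isGenericType h𝕂 hκ hℵ hk hX, fun p hp =>
    ⟨fun hV => DVar.DVariety.isStationary_of_isAbsolutelyIrreducible h𝕂 hκ hℵ hk hX hV hp,
      DVar.DVariety.isAbsolutelyIrreducible_of_isStationary h𝕂 hκ hℵ hk hX hp⟩⟩
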